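/- Let $n\ge 1$, let $\Sigma$ be a compact smooth $2n$-dimensional manifold with boundary, and let $\beta$ be a smooth $1$-form on $\Sigma$ such that $d\beta$ is symplectic and $\partial\Sigma$ is convex, i.e. the Liouville vector field $X$ defined by $d\beta(X,\cdot)=\beta$ points strictly outward along $\partial\Sigma$. Let $\mathrm{Exact}(\Sigma,\partial\Sigma,d\beta)$ be the group of diffeomorphisms $\psi$ of $\Sigma$ that are the identity near $\partial\Sigma$ and satisfy $\psi^*\beta-\beta=dh$ for some smooth $h:\Sigma\to\mathbb R$, and let $\varphi\in \mathrm{Exact}(\Sigma,\partial\Sigma,d\beta)$. Let $$M=M(\Sigma,\varphi)=(\Sigma\times\mathbb R)/\big((x,t)\sim(\varphi(x),t+1)\big)$$ (equivalently $\Sigma\times[0,1]$ with $(x,0)$ glued to $(\varphi(x),1)$) be the mapping torus, with projection $\pi:M\to S^1$, $\pi[x,t]=e^{2\pi i t}$, and let $d\theta$ be the angular form on $S^1$. By a trivialization of $\pi$ with structure group $\mathrm{Exact}(\Sigma,\partial\Sigma,d\beta)$ over an open set $U\subset S^1$ we mean a diffeomorphism $\Phi:\pi^{-1}(U)\to U\times\Sigma$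 over $U$ such that, for all $t$ with $e^{2\pi i t}\in U$, the map $g_t: x\mapsto p_2(\Phi([x,t]))$ belongs to $\mathrm{Exact}(\Sigma,\partial\Sigma,d\beta)$ and, locally uniformly in $t$, $g_t$ is the identity on a neighbourhood of $\partial\Sigma$; here $p_2:U\times\Sigma\to\Sigma$ is the projection. Then there are two such trivializations $\Phi_1,\Phi_2$ over open sets $U_1,U_2\subset S^1$ admitting a smooth partition of unity on $S^1$ subordinate to $\{U_1,U_2\}$. Moreover, for every family of such trivializations $\Phi_\rho$ over open sets $U_\rho$ and every smooth partition of unity $\{f_\rho\}$ on $S^1$ subordinate to $\{U_\rho\}$, put $$\lambda_\beta=\sum_\rho (f_\rho\circ\pi)\,\Phi_\rho^*(p_2^*\beta),\qquad \sigma=\lambda_\beta+K\,\pi^*(d\theta).$$ Then there is $K_0>0$ such that for all $K\ge K_0$: 1. $\sigma$ is a contact form on $M$, i.e. $\sigma$ is smooth and $\sigma\wedge(d\sigma)^n$ vanishes nowhere; so $\eta=\ker\sigma$ is a co-oriented contact structure on $M$; 2. $d\sigma$ restricts to an exact symplectic form on every fiber of $\pi$, i.e. $\eta$ is compatible with $\pi$;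 3. $\sigma$ is a product form near $\partial M\cong\partial\Sigma\times S^1$: there is an open neighbourhood $V$ of $\partial\Sigma$ in $\Sigma$ such that $(x,e^{2\pi i t})\mapsto[x,t]$ is a well-defined diffeomorphism from $V\times S^1$ onto an open neighbourhood of $\partial M$ in $M$, and pulls $\sigma$ back to $\beta+K\,d\theta$. -/

import Mathlib

open scoped Manifold ContDiff Topology
open Set

noncomputable section

namespace ContactTorus

/-! ### Differential forms on manifolds with boundary -/

section Forms

variable {E : Type*} [NormedAddCommGroup E] [NormedSpace ℝ E]
  {H : Type*} [TopologicalSpace H]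
  {E' : Type*} [NormedAddCommGroup E'] [NormedSpace ℝ E']
  {H' : Type*} [TopologicalSpace H']

/-- Real-valued differential `k`-forms on `M`, without regularity. -/
abbrev DForm (I : ModelWithCorners ℝ E H) (M : Type*) [TopologicalSpace M] [ChartedSpace H M]
    (k : ℕ) : Type _ :=
  ∀ x : M, TangentSpace I x [⋀^Fin k]→L[ℝ] ℝ

/-- The `1`-form given by a family of continuous linear functionals. -/
def oneForm {I : ModelWithCorners ℝ E H} {M : Type*} [TopologicalSpace M] [ChartedSpace H M]
    (f : ∀ x : M, TangentSpace I x →L[ℝ] ℝ) : DForm I M 1 :=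
  fun x => ContinuousAlternatingMap.ofSubsingleton ℝ (TangentSpace I x) ℝ (0 : Fin 1) (f x)

/-- The differential `dh` of a function `h : M → ℝ`. -/
def differential (I : ModelWithCorners ℝ E H) {M : Type*} [TopologicalSpace M] [ChartedSpace H M]
    (h : M → ℝ) : DForm I M 1 :=
  oneForm fun x => (mfderiv I 𝓘(ℝ, ℝ) h x : TangentSpace I x →L[ℝ] ℝ)

variable {I : ModelWithCorners ℝ E H} {I' : ModelWithCorners ℝ E' H'}
  {M : Type*} [TopologicalSpace M] [ChartedSpace H M]
  {M' : Type*} [TopologicalSpace M'] [ChartedSpace H' M'] {k : ℕ}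

/-- The pullback `f^* η` along a map `f : M → M'`. -/
def DForm.pullback (I : ModelWithCorners ℝ E H) (f : M → M') (η : DForm I' M' k) : DForm I M k :=
  fun x => (η (f x)).compContinuousLinearMap (mfderiv I I' f x)

/-- The coordinate expression of `η` in the chart at `x₀`: its pullback along the inverse chart,
a form on the subset `(extChartAt I x₀).target` of the model vector space. -/
def DForm.inChart (η : DForm I M k) (x₀ : M) : E → E [⋀^Fin k]→L[ℝ] ℝ :=
  fun y => (η ((extChartAt I x₀).symm y)).compContinuousLinearMap
    (mfderivWithin 𝓘(ℝ, E) I (extChartAt I x₀).symm (range I) y)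

/-- A form is smooth if its coordinate expressions are. -/
def DForm.IsSmooth (η : DForm I M k) : Prop :=
  ∀ x₀ : M, ContDiffOn ℝ ∞ (η.inChart x₀) (extChartAt I x₀).target

/-- The exterior derivative, computed at `x` in the chart at `x`. -/
def DForm.d (η : DForm I M k) : DForm I M (k + 1) :=
  fun x => (extDerivWithin (η.inChart x) (range I) (extChartAt I x x)).compContinuousLinearMap
    (mfderiv I 𝓘(ℝ, E) (extChartAt I x) x)

/-- Nondegeneracy of a `2`-form at every point. -/
def DForm.IsNondegenerate (η : DForm I M 2) : Prop :=
  ∀ (x : M) (v : TangentSpace I x), (∀ w : TangentSpace I x, η x ![v, w] = 0) → v = 0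

/-- An exact symplectic form: nondegenerate, with a smooth primitive. -/
def DForm.IsExactSymplectic (η : DForm I M 2) : Prop :=
  (∃ α : DForm I M 1, α.IsSmooth ∧ α.d = η) ∧ η.IsNondegenerate

/-- The exterior product of alternating forms (sum over shuffles). -/
def wedge {V : Type*} [AddCommGroup V] [Module ℝ V] {k l : ℕ}
    (a : V [⋀^Fin k]→ₗ[ℝ] ℝ) (b : V [⋀^Fin l]→ₗ[ℝ] ℝ) : V [⋀^Fin (k + l)]→ₗ[ℝ] ℝ :=
  ((LinearMap.mul' ℝ ℝ).compAlternatingMap (a.domCoprod b)).domDomCongr finSumFinEquiv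

/-- The exterior power `η ∧ ⋯ ∧ η` (`m` factors) of an alternating `2`-form. -/
def wedgePow {V : Type*} [AddCommGroup V] [Module ℝ V] (η : V [⋀^Fin 2]→ₗ[ℝ] ℝ) :
    (m : ℕ) → V [⋀^Fin (2 * m)]→ₗ[ℝ] ℝ
  | 0 => AlternatingMap.constOfIsEmpty ℝ V (Fin 0) 1
  | m + 1 => wedge (wedgePow η m) η

/-- `σ` is a contact form on the `(2n+1)`-dimensional manifold `M`: a smooth `1`-form for which
`σ ∧ (dσ)ⁿ` vanishes nowhere. -/
def DForm.IsContactForm (n : ℕ) (σ : DForm I M 1) : Prop :=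
  σ.IsSmooth ∧
    ∀ x : M, wedge (σ x).toAlternatingMap (wedgePow (σ.d x).toAlternatingMap n) ≠ 0

end Forms

/-- The angular `1`-form `dθ` on the unit circle: `dθ_z(v) = Im (z̄ v)` for `v` tangent to the circle
at `z`, viewed as a complex number. -/
def dTheta : DForm (𝓡 1) Circle 1 :=
  oneForm fun z => (Complex.imCLM.comp
    ((ContinuousLinearMap.mul ℝ ℂ ((starRingEnd ℂ) (z : ℂ))).comp
      (mfderiv (𝓡 1) 𝓘(ℝ, ℂ) (fun w : Circle => (w : ℂ)) z :
        TangentSpace (𝓡 1) z →L[ℝ] ℂ)) : TangentSpace (𝓡 1) z →L[ℝ] ℝ)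

/-! ### Exact symplectomorphisms and convex boundary -/

section Exact

variable {E : Type*} [NormedAddCommGroup E] [NormedSpace ℝ E]
  {H : Type*} [TopologicalSpace H] {I : ModelWithCorners ℝ E H}
  {S : Type*} [TopologicalSpace S] [ChartedSpace H S]

/-- Membership in `Exact(S, ∂S, dβ)`: `φ^* β - β = dh` for some smooth function `h`, and `φ` is
the identity on a neighbourhood of the boundary. -/
def IsExactRelBoundary (β : DForm I S 1) (φ : S ≃ₘ⟮I, I⟯ S) : Prop :=
  (∃ h : S → ℝ, ContMDiff I 𝓘(ℝ, ℝ) ∞ h ∧ DForm.pullback I φ β - β = differential I h) ∧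
    ∀ᶠ x in 𝓝ˢ (I.boundary S), φ x = x

/-- The boundary is convex for `β`: at each boundary point the Liouville vector `X`, defined by
`dβ(X, ·) = β`, points strictly outward (its normal coordinate in a half-space chart
is negative). -/
def HasConvexBoundary {d : ℕ} [NeZero d] {S : Type*} [TopologicalSpace S]
    [ChartedSpace (EuclideanHalfSpace d) S] (β : DForm (𝓡∂ d) S 1) : Prop :=
  ∀ x ∈ (𝓡∂ d).boundary S, ∀ X : TangentSpace (𝓡∂ d) x,
    (∀ w : TangentSpace (𝓡∂ d) x, β.d x ![X, w] = β x ![w]) →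
      (EuclideanSpace.proj (0 : Fin d) : EuclideanSpace ℝ (Fin d) →L[ℝ] ℝ)
        (mfderiv (𝓡∂ d) 𝓘(ℝ, EuclideanSpace ℝ (Fin d)) (extChartAt (𝓡∂ d) x) x X) < 0

end Exact

/-! ### The mapping torus -/

section MappingTorus

variable {E : Type*} [NormedAddCommGroup E] [NormedSpace ℝ E]
  {H : Type*} [TopologicalSpace H] {I : ModelWithCorners ℝ E H}
  {S : Type*} [TopologicalSpace S] [ChartedSpace H S]

/-- The deck transformation `(x, t) ↦ (φᵏ x, t + k)` of `S × ℝ`. -/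
def deck (φ : S ≃ₘ⟮I, I⟯ S) (k : ℤ) (p : S × ℝ) : S × ℝ :=
  ((φ.toEquiv ^ k : Equiv.Perm S) p.1, p.2 + k)

theorem deck_zero (φ : S ≃ₘ⟮I, I⟯ S) (p : S × ℝ) : deck φ 0 p = p := by
  simp [deck]

theorem deck_add (φ : S ≃ₘ⟮I, I⟯ S) (k l : ℤ) (p : S × ℝ) :
    deck φ (k + l) p = deck φ k (deck φ l p) := by
  simp only [deck, zpow_add, Equiv.Perm.mul_apply, Int.cast_add, Prod.mk.injEq, true_and]
  ring

/-- Two points of `S × ℝ` are identified if a deck transformation takes one to the other. -/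
def torusSetoid (φ : S ≃ₘ⟮I, I⟯ S) : Setoid (S × ℝ) where
  r p q := ∃ k : ℤ, deck φ k p = q
  iseqv :=
    { refl := fun p => ⟨0, deck_zero φ p⟩
      symm := by
        rintro p _ ⟨k, rfl⟩
        exact ⟨-k, by rw [← deck_add, neg_add_cancel, deck_zero]⟩
      trans := by
        rintro p _ _ ⟨k, rfl⟩ ⟨l, rfl⟩
        exact ⟨l + k, deck_add φ l k p⟩ }

/-- The mapping torus of `φ`: the quotient of `S × ℝ` by `(x, t) ∼ (φ x, t + 1)`, that is,
`S × [0, 1]` with each `(x, 0)` glued to `(φ x, 1)`. -/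
def MappingTorus (φ : S ≃ₘ⟮I, I⟯ S) : Type _ :=
  Quotient (torusSetoid φ)

namespace MappingTorus

variable (φ : S ≃ₘ⟮I, I⟯ S)

instance : TopologicalSpace (MappingTorus φ) :=
  inferInstanceAs (TopologicalSpace (Quotient (torusSetoid φ)))

/-- The quotient map `S × ℝ → MappingTorus φ`. -/
def mk (p : S × ℝ) : MappingTorus φ :=
  Quotient.mk (torusSetoid φ) p

theorem mk_surjective : Function.Surjective (mk φ) :=
  Quotient.mk_surjective

theorem mk_eq_iff {p q : S × ℝ} : mk φ p = mk φ q ↔ ∃ k : ℤ, deck φ k p = q :=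
  Quotient.eq (r := torusSetoid φ)

theorem mk_deck (k : ℤ) (p : S × ℝ) : mk φ (deck φ k p) = mk φ p :=
  ((mk_eq_iff φ).2 ⟨k, rfl⟩).symm

theorem contMDiff_zpow (k : ℤ) :
    ContMDiff I I ∞ (fun x : S => (φ.toEquiv ^ k : Equiv.Perm S) x) := by
  have hpos : ∀ (ψ : S ≃ₘ⟮I, I⟯ S) (m : ℕ),
      ContMDiff I I ∞ (fun x : S => (ψ.toEquiv ^ m : Equiv.Perm S) x) := by
    intro ψ m
    induction m with
    | zero => exact contMDiff_id
    | succ m ih =>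
      simp only [pow_succ, Equiv.Perm.mul_apply]
      exact ih.comp ψ.contMDiff
  obtain ⟨m, rfl | rfl⟩ := k.eq_nat_or_neg
  · simpa using hpos φ m
  · have h := hpos φ.symm m
    simp only [zpow_neg, zpow_natCast, ← inv_pow]
    exact h

theorem contMDiff_deck (k : ℤ) :
    ContMDiff (I.prod 𝓘(ℝ, ℝ)) (I.prod 𝓘(ℝ, ℝ)) ∞ (deck φ k) := by
  refine ((contMDiff_zpow φ k).comp contMDiff_fst).prodMk ?_
  have h : ContMDiff 𝓘(ℝ, ℝ) 𝓘(ℝ, ℝ) ∞ (fun t : ℝ => t + (k : ℝ)) :=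
    (contDiff_id.add contDiff_const).contMDiff
  exact h.comp contMDiff_snd

theorem continuous_mk : Continuous (mk φ) :=
  continuous_quotient_mk'

theorem isOpenMap_mk : IsOpenMap (mk φ) := by
  intro U hU
  have h : mk φ ⁻¹' (mk φ '' U) = ⋃ k : ℤ, deck φ k ⁻¹' U := by
    ext p
    simp only [mem_preimage, mem_image, mem_iUnion]
    constructor
    · rintro ⟨q, hq, hqp⟩
      obtain ⟨k, hk⟩ := (mk_eq_iff φ).1 hqp.symm
      exact ⟨k, hk ▸ hq⟩
    · rintro ⟨k, hk⟩
      exact ⟨_, hk, mk_deck φ k p⟩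
  refine (isQuotientMap_quotient_mk' (s := torusSetoid φ)).isOpen_preimage.1 ?_
  change IsOpen (mk φ ⁻¹' (mk φ '' U))
  rw [h]
  exact isOpen_iUnion fun k => hU.preimage (contMDiff_deck φ k).continuous

theorem isLocalHomeomorph_mk : IsLocalHomeomorph (mk φ) := by
  rw [isLocalHomeomorph_iff_isOpenEmbedding_restrict]
  intro p
  let U : Set (S × ℝ) := Prod.snd ⁻¹' Metric.ball p.2 (1 / 2)
  have hU : IsOpen U := Metric.isOpen_ball.preimage continuous_snd
  refine ⟨U, hU.mem_nhds (by simp [U]), ?_⟩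
  refine Topology.IsOpenEmbedding.of_continuous_injective_isOpenMap
    ((continuous_mk φ).comp continuous_subtype_val) ?_ ((isOpenMap_mk φ).domRestrict hU)
  rintro ⟨a, ha⟩ ⟨b, hb⟩ hab
  obtain ⟨k, hk⟩ := (mk_eq_iff φ).1 hab
  have h2 : a.2 + k = b.2 := congrArg Prod.snd hk
  simp only [U, mem_preimage, Metric.mem_ball, Real.dist_eq, abs_lt] at ha hb
  have h3 : (k : ℝ) < 1 := by linarith
  have h4 : (-1 : ℝ) < k := by linarith
  have hk0 : k = 0 := by
    have h5 : k < 1 := by exact_mod_cast h3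
    have h6 : -1 < k := by exact_mod_cast h4
    omega
  subst hk0
  rw [deck_zero] at hk
  exact Subtype.ext hk

/-- The smooth structure of the mapping torus: the charts of `S × ℝ`, transported by the local
inverses of the quotient map. -/
instance : ChartedSpace (ModelProd H ℝ) (MappingTorus φ) :=
  (isLocalHomeomorph_mk φ).chartedSpace (mk_surjective φ)

theorem contMDiffAt_localInverse_transition (b p : S × ℝ)
    (hp : mk φ p ∈ ((isLocalHomeomorph_mk φ).localInverseAt b).source) :
    ContMDiffAt (I.prod 𝓘(ℝ, ℝ)) (I.prod 𝓘(ℝ, ℝ)) ∞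
      (fun z => (isLocalHomeomorph_mk φ).localInverseAt b (mk φ z)) p := by
  have hq := isLocalHomeomorph_mk φ
  obtain ⟨k, hk⟩ := (mk_eq_iff φ).1 (hq.apply_localInverseAt_of_mem hp).symm
  refine (contMDiff_deck φ k p).congr_of_eventuallyEq ?_
  have hmem : deck φ k p ∈ (hq.localInverseAt b).target := by
    rw [hk]
    exact (hq.localInverseAt b).map_source hp
  filter_upwards [(contMDiff_deck φ k).continuous.continuousAt.preimage_mem_nhds
    ((hq.localInverseAt b).open_target.mem_nhds hmem)] with z hz
  have h := (hq.localInverseAt b).right_inv hz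
  rwa [hq.localInverseAt_symm, mk_deck] at h

instance [IsManifold I ∞ S] : IsManifold (I.prod 𝓘(ℝ, ℝ)) ∞ (MappingTorus φ) := by
  have hq := isLocalHomeomorph_mk φ
  refine isManifold_of_contDiffOn _ _ _ ?_
  rintro _ _ ⟨a, rfl⟩ ⟨b, rfl⟩
  generalize (mk_surjective φ).hasRightInverse.choose a = a
  generalize (mk_surjective φ).hasRightInverse.choose b = b
  rw [← contMDiffOn_iff_contDiffOn]
  refine (I.prod 𝓘(ℝ, ℝ)).contMDiff.comp_contMDiffOn ?_
  have h1 : ContMDiffOn (I.prod 𝓘(ℝ, ℝ)) (I.prod 𝓘(ℝ, ℝ)) ∞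
      (fun y => chartAt (ModelProd H ℝ) b (hq.localInverseAt b
        (mk φ ((chartAt (ModelProd H ℝ) a).symm y))))
      {y | y ∈ (chartAt (ModelProd H ℝ) a).target ∧
        mk φ ((chartAt (ModelProd H ℝ) a).symm y) ∈ (hq.localInverseAt b).source ∧
        hq.localInverseAt b (mk φ ((chartAt (ModelProd H ℝ) a).symm y)) ∈
          (chartAt (ModelProd H ℝ) b).source} := by
    rintro y ⟨hy1, hy2, hy3⟩
    have c1 := (contMDiffOn_chart_symm (I := I.prod 𝓘(ℝ, ℝ)) (n := ∞) (x := a)).contMDiffAt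
      ((chartAt (ModelProd H ℝ) a).open_target.mem_nhds hy1)
    have c2 := contMDiffAt_localInverse_transition φ b _ hy2
    have c3 := (contMDiffOn_chart (I := I.prod 𝓘(ℝ, ℝ)) (n := ∞) (x := b)).contMDiffAt
      ((chartAt (ModelProd H ℝ) b).open_source.mem_nhds hy3)
    exact (c3.comp y (c2.comp y c1)).contMDiffWithinAt
  have h2 := h1.comp ((I.prod 𝓘(ℝ, ℝ)).contMDiffOn_symm (n := ∞) |>.mono
    (inter_subset_right (s := (I.prod 𝓘(ℝ, ℝ)).symm ⁻¹'
      (((hq.localInverseAt a).trans (chartAt (ModelProd H ℝ) a)).symm.trans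
        ((hq.localInverseAt b).trans (chartAt (ModelProd H ℝ) b))).source))) ?_
  · refine h2.congr ?_
    intro y hy
    simp
  · rintro y ⟨hy, -⟩
    simp at hy ⊢
    tauto

/-- The projection `π : [x, t] ↦ exp(2πit)` onto the circle. -/
def proj : MappingTorus φ → Circle :=
  Quotient.lift (fun p : S × ℝ => Circle.exp (2 * Real.pi * p.2)) (by
    rintro p _ ⟨k, rfl⟩
    refine Circle.ext ?_
    simp only [deck, Circle.coe_exp, Complex.exp_eq_exp_iff_exists_int]
    exact ⟨-k, by push_cast; ring⟩)

/-- The parametrization `x ↦ [x, t]` of the fibre of `proj` over `exp(2πit)` by `S`. -/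
def fiberMap (t : ℝ) (x : S) : MappingTorus φ :=
  mk φ (x, t)

theorem range_fiberMap (t : ℝ) :
    range (fiberMap φ t) = proj φ ⁻¹' {Circle.exp (2 * Real.pi * t)} := by
  ext p
  obtain ⟨⟨x, s⟩, rfl⟩ := mk_surjective φ p
  change (∃ y, mk φ (y, t) = mk φ (x, s)) ↔
    Circle.exp (2 * Real.pi * s) = Circle.exp (2 * Real.pi * t)
  have hpi : (2 * Real.pi : ℝ) ≠ 0 := by positivity
  rw [Circle.exp_eq_exp]
  constructor
  · rintro ⟨y, hy⟩
    obtain ⟨k, hk⟩ := (mk_eq_iff φ).1 hy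
    have h2 : t + k = s := congrArg Prod.snd hk
    exact ⟨k, by rw [← h2]; ring⟩
  · rintro ⟨m, hm⟩
    have h2 : s = t + m := mul_left_cancel₀ hpi (by rw [hm]; ring)
    refine ⟨(φ.toEquiv ^ (-m) : Equiv.Perm S) x, (mk_eq_iff φ).2 ⟨m, ?_⟩⟩
    simp [deck, h2]

end MappingTorus

open MappingTorus

/-- A smooth local trivialization `π⁻¹(U) ≅ U × S` of the mapping torus, belonging to its bundle
structure with group `Exact(S, ∂S, dβ)`: on the fibre over `exp(2πit)`, parametrized by
`x ↦ [x, t]`, the `S`-component is an element of `Exact(S, ∂S, dβ)`, and these elements are the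
identity near the boundary locally uniformly in `t`. -/
structure ExactTrivialization (β : DForm I S 1) (φ : S ≃ₘ⟮I, I⟯ S) where
  baseSet : Set Circle
  toHomeo : OpenPartialHomeomorph (MappingTorus φ) (Circle × S)
  source_eq : toHomeo.source = proj φ ⁻¹' baseSet
  target_eq : toHomeo.target = baseSet ×ˢ univ
  smooth : ContMDiffOn (I.prod 𝓘(ℝ, ℝ)) ((𝓡 1).prod I) ∞ toHomeo toHomeo.source
  smooth_symm : ContMDiffOn ((𝓡 1).prod I) (I.prod 𝓘(ℝ, ℝ)) ∞ toHomeo.symm toHomeo.target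
  fst_eq : ∀ p ∈ toHomeo.source, (toHomeo p).1 = proj φ p
  exact_fiber : ∀ t : ℝ, Circle.exp (2 * Real.pi * t) ∈ baseSet →
    ∃ ψ : S ≃ₘ⟮I, I⟯ S, IsExactRelBoundary β ψ ∧ ∀ x : S, (toHomeo (fiberMap φ t x)).2 = ψ x
  eq_near_boundary : ∀ t₀ : ℝ, Circle.exp (2 * Real.pi * t₀) ∈ baseSet →
    ∃ V ∈ 𝓝ˢ (I.boundary S), ∀ᶠ t in 𝓝 t₀, ∀ x ∈ V, (toHomeo (fiberMap φ t x)).2 = x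

/-- The patched form `λ_β = ∑ᵢ (fᵢ ∘ π) · Φᵢ^* (p₂^* β)`, for local trivializations `Φᵢ` over
`Uᵢ` and a partition of unity `fᵢ` on the circle. -/
def patchedForm {β : DForm I S 1} {φ : S ≃ₘ⟮I, I⟯ S} {ι : Type*}
    (Φ : ι → ExactTrivialization β φ) (f : SmoothPartitionOfUnity ι (𝓡 1) Circle univ) :
    DForm (I.prod 𝓘(ℝ, ℝ)) (MappingTorus φ) 1 :=
  fun p => ∑ᶠ i, f i (proj φ p) •
    DForm.pullback (I.prod 𝓘(ℝ, ℝ)) (Φ i).toHomeo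
      (DForm.pullback ((𝓡 1).prod I) (Prod.snd : Circle × S → S) β) p

/-- The form `σ = λ_β + K π^* dθ`. -/
def bundleForm {β : DForm I S 1} {φ : S ≃ₘ⟮I, I⟯ S} {ι : Type*}
    (Φ : ι → ExactTrivialization β φ) (f : SmoothPartitionOfUnity ι (𝓡 1) Circle univ) (K : ℝ) :
    DForm (I.prod 𝓘(ℝ, ℝ)) (MappingTorus φ) 1 :=
  patchedForm Φ f + K • DForm.pullback (I.prod 𝓘(ℝ, ℝ)) (proj φ) dTheta

/-- `dσ` restricts to an exact symplectic form on every fibre of the projection to the circle. -/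
def IsExactSymplecticOnFibers (φ : S ≃ₘ⟮I, I⟯ S)
    (σ : DForm (I.prod 𝓘(ℝ, ℝ)) (MappingTorus φ) 1) : Prop :=
  ∀ t : ℝ, (DForm.pullback I (fiberMap φ t) σ.d).IsExactSymplectic

/-- `σ` is the product form `β + K dθ` near the boundary: for some open neighbourhood `V` of
`∂S` in `S`, the map `(x, exp(2πit)) ↦ [x, t]` is a diffeomorphism from `V × S¹` onto an open
neighbourhood of the boundary of the mapping torus, and pulls `σ` back to `β + K dθ`. -/
def IsProductNearBoundary (β : DForm I S 1) (φ : S ≃ₘ⟮I, I⟯ S) (K : ℝ)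
    (σ : DForm (I.prod 𝓘(ℝ, ℝ)) (MappingTorus φ) 1) : Prop :=
  ∃ (V : Set S) (Ψ : OpenPartialHomeomorph (S × Circle) (MappingTorus φ)),
    IsOpen V ∧ I.boundary S ⊆ V ∧ Ψ.source = V ×ˢ univ ∧
    (I.prod 𝓘(ℝ, ℝ)).boundary (MappingTorus φ) ⊆ Ψ.target ∧
    ContMDiffOn (I.prod (𝓡 1)) (I.prod 𝓘(ℝ, ℝ)) ∞ Ψ Ψ.source ∧
    ContMDiffOn (I.prod 𝓘(ℝ, ℝ)) (I.prod (𝓡 1)) ∞ Ψ.symm Ψ.target ∧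
    (∀ x ∈ V, ∀ t : ℝ, Ψ (x, Circle.exp (2 * Real.pi * t)) = fiberMap φ t x) ∧
    ∀ p ∈ Ψ.source, DForm.pullback (I.prod (𝓡 1)) Ψ σ p =
      DForm.pullback (I.prod (𝓡 1)) Prod.fst β p +
        K • DForm.pullback (I.prod (𝓡 1)) Prod.snd dTheta p

end MappingTorus

end ContactTorus

end

/-! Write λ for the patched form. Since dθ is closed, dσ = dλ for every K, so σ ∧ (dσ)ⁿ = λ ∧ (dλ)ⁿ
+ K · π^*dθ ∧ (dλ)ⁿ is affine in K. If the coefficient of K vanishes nowhere, then compactness of M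
lets it dominate the first term uniformly once K is large (`exists_forall_wedge_wedgePow_ne_zero`).

The coefficient is controlled on the fibres. On the fibre over exp(2πit), parametrized by x ↦ [x,
t], a trivialization acts as some ψᵢ with ψᵢ^*β = β + dhᵢ. The weights fᵢ ∘ π are constant there and
sum to 1, so λ restricts to β + d(∑ fᵢhᵢ) and dλ restricts to dβ
(`pullback_fiberMap_d_patchedForm`). This is already the symplectic condition on fibres. Moreover
π^*dθ kills the vectors tangent to a fibre and takes the value 2π on ∂/∂t, and a symplectic form on
a 2n-dimensional subspace wedged with such a covector is nonzero. The last fact is proved by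
evaluating on ∂/∂t and a symplectic basis: in the expansion over permutations
(`wedge_wedgePow_apply`) all terms have the same sign, so nothing cancels.

Near the boundary, φ and all trivializations with nonzero weight are the identity in the
S-direction. Compactness of a period [0, 1] makes the neighbourhood independent of t
(`exists_nhds_boundary_eq_id`). On it every term of λ is fᵢβ, and the sum is β.

The trivializations needed for existence come from two branches of the angle, each cut at one point.
Their fibre maps are powers of φ, and Exact(Σ, ∂Σ, dβ) contains these.

Underneath lies a calculus of forms on manifolds with boundary, whose main point is that d commutes
with pullback (`DForm.d_pullback`). -/

noncomputable section

namespace ContactTorus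

/-! ### Forms in charts: smoothness, pullback, and naturality of d. -/

section FormCalculus

variable {E : Type*} [NormedAddCommGroup E] [NormedSpace ℝ E]
  {H : Type*} [TopologicalSpace H]
  {E' : Type*} [NormedAddCommGroup E'] [NormedSpace ℝ E']
  {H' : Type*} [TopologicalSpace H']
  {E'' : Type*} [NormedAddCommGroup E''] [NormedSpace ℝ E'']
  {H'' : Type*} [TopologicalSpace H'']
  {I : ModelWithCorners ℝ E H} {I' : ModelWithCorners ℝ E' H'} {I'' : ModelWithCorners ℝ E'' H''}
  {M : Type*} [TopologicalSpace M] [ChartedSpace H M]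
  {M' : Type*} [TopologicalSpace M'] [ChartedSpace H' M']
  {M'' : Type*} [TopologicalSpace M''] [ChartedSpace H'' M''] {k : ℕ}

/-- Smoothness of a form near a point, in terms of the chart at that point. -/
def DForm.SmoothAt (η : DForm I M k) (x : M) : Prop :=
  ContDiffWithinAt ℝ ∞ (η.inChart x) (range I) (extChartAt I x x)

/-- The type of `η x` depends on `x`, which blocks rewriting the base point. Viewing every tangent
space as the model space removes the dependence. -/
theorem compContinuousLinearMap_congr_point (η : DForm I M k) {x y : M} (h : x = y)
    (A B : E'' →L[ℝ] E) (hAB : A = B) :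
    (show E [⋀^Fin k]→L[ℝ] ℝ from η x).compContinuousLinearMap A =
      (show E [⋀^Fin k]→L[ℝ] ℝ from η y).compContinuousLinearMap B := by
  subst h hAB; rfl

theorem DForm.pullback_comp_apply (η : DForm I'' M'' k) {g : M' → M''} {f : M → M'} {x : M}
    (hg : MDifferentiableAt I' I'' g (f x)) (hf : MDifferentiableAt I I' f x) :
    DForm.pullback I (g ∘ f) η x = DForm.pullback I f (DForm.pullback I' g η) x := by
  unfold DForm.pullback
  rw [mfderiv_comp x hg hf]
  rfl

theorem DForm.pullback_congr_apply (η : DForm I' M' k) {f g : M → M'} {x : M}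
    (h : f =ᶠ[𝓝 x] g) : DForm.pullback I f η x = DForm.pullback I g η x :=
  compContinuousLinearMap_congr_point (E'' := E) η h.self_of_nhds _ _ h.mfderiv_eq

theorem DForm.pullback_id (η : DForm I M k) : DForm.pullback I id η = η := by
  funext x
  unfold DForm.pullback
  rw [mfderiv_id]
  rfl

variable [IsManifold I ∞ M] [IsManifold I' ∞ M'] [IsManifold I'' ∞ M'']

/-- By the chain rule, the derivative of the inverse chart at y₀ cancels that of the chart at y₀,
leaving only the derivative of F read in coordinates. -/
theorem DForm.inChart_pullback (η : DForm I' M' k) {F : M → M'} {x₀ : M} {y₀ : M'} {z : E}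
    (hz : z ∈ (extChartAt I x₀).target)
    (hF : MDifferentiableAt I I' F ((extChartAt I x₀).symm z))
    (hy : F ((extChartAt I x₀).symm z) ∈ (extChartAt I' y₀).source) :
    (DForm.pullback I F η).inChart x₀ z =
      (η.inChart y₀ (extChartAt I' y₀ (F ((extChartAt I x₀).symm z)))).compContinuousLinearMap
        (fderivWithin ℝ (extChartAt I' y₀ ∘ F ∘ (extChartAt I x₀).symm) (range I) z) := by
  have : IsManifold I 1 M := .of_le (n := ∞) (by simp)
  have : IsManifold I' 1 M' := .of_le (n := ∞) (by simp)
  have hzr : z ∈ range I := extChartAt_target_subset_range x₀ hz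
  have hU : UniqueMDiffWithinAt 𝓘(ℝ, E) (range I) z := I.uniqueMDiffOn z hzr
  have hs := mdifferentiableWithinAt_extChartAt_symm (I := I) hz
  have h1 : mfderivWithin 𝓘(ℝ, E) I' (F ∘ (extChartAt I x₀).symm) (range I) z =
      (mfderiv I I' F ((extChartAt I x₀).symm z)).comp
        (mfderivWithin 𝓘(ℝ, E) I (extChartAt I x₀).symm (range I) z) :=
    mfderiv_comp_mfderivWithin z hF hs hU
  have hFs : MDifferentiableWithinAt 𝓘(ℝ, E) I' (F ∘ (extChartAt I x₀).symm) (range I) z :=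
    hF.comp_mdifferentiableWithinAt z hs
  have hys : F ((extChartAt I x₀).symm z) ∈ (chartAt H' y₀).source := by
    rwa [← extChartAt_source (I := I')]
  have h2 : mfderivWithin 𝓘(ℝ, E) 𝓘(ℝ, E') (extChartAt I' y₀ ∘ F ∘ (extChartAt I x₀).symm)
        (range I) z =
      (mfderiv I' 𝓘(ℝ, E') (extChartAt I' y₀) (F ((extChartAt I x₀).symm z))).comp
        (mfderivWithin 𝓘(ℝ, E) I' (F ∘ (extChartAt I x₀).symm) (range I) z) :=
    mfderiv_comp_mfderivWithin z (mdifferentiableAt_extChartAt hys) hFs hU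
  have h3 := mfderivWithin_extChartAt_symm_comp_mfderiv_extChartAt' (I := I') hy
  rw [mfderivWithin_eq_fderivWithin] at h2
  rw [h2]
  refine compContinuousLinearMap_congr_point (E'' := E) η ((extChartAt I' y₀).left_inv hy).symm
    _ (ContinuousLinearMap.comp (mfderivWithin 𝓘(ℝ, E') I' (extChartAt I' y₀).symm (range I')
      (extChartAt I' y₀ (F ((extChartAt I x₀).symm z))))
      (ContinuousLinearMap.comp (mfderiv I' 𝓘(ℝ, E') (extChartAt I' y₀)
        (F ((extChartAt I x₀).symm z))) (mfderivWithin 𝓘(ℝ, E) I'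
          (F ∘ (extChartAt I x₀).symm) (range I) z))) (h1.symm.trans ?_)
  ext v
  exact (DFunLike.congr_fun h3 _).symm

theorem eventually_inChart_pullback (η : DForm I' M' k) {F : M → M'} {x₀ x : M} {y₀ : M'}
    (hx : x ∈ (extChartAt I x₀).source) (hF : ContMDiffAt I I' ∞ F x)
    (hy : F x ∈ (extChartAt I' y₀).source) :
    (DForm.pullback I F η).inChart x₀ =ᶠ[𝓝[range I] (extChartAt I x₀ x)] fun z =>
      (η.inChart y₀ ((extChartAt I' y₀ ∘ F ∘ (extChartAt I x₀).symm) z)).compContinuousLinearMap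
        (fderivWithin ℝ (extChartAt I' y₀ ∘ F ∘ (extChartAt I x₀).symm) (range I) z) := by
  have : IsManifold I 1 M := .of_le (n := ∞) (by simp)
  have : IsManifold I' 1 M' := .of_le (n := ∞) (by simp)
  have h1 : ∀ᶠ x' in 𝓝 x, MDifferentiableAt I I' F x' ∧ F x' ∈ (extChartAt I' y₀).source := by
    have hF1 : ContMDiffAt I I' 1 F x := hF.of_le (by simp)
    filter_upwards [(contMDiffAt_iff_contMDiffAt_nhds (by simp)).1 hF1, hF.continuousAt.preimage_mem_nhds
      ((isOpen_extChartAt_source y₀).mem_nhds hy)] with x' h h'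
    exact ⟨h.mdifferentiableAt (by simp), h'⟩
  have h2 : Filter.Tendsto (extChartAt I x₀).symm (𝓝[range I] (extChartAt I x₀ x)) (𝓝 x) := by
    have := (continuousAt_extChartAt_symm' hx).tendsto
    rw [(extChartAt I x₀).left_inv hx] at this
    exact this.mono_left nhdsWithin_le_nhds
  filter_upwards [h2.eventually h1, extChartAt_target_mem_nhdsWithin' hx] with z hz hzt
  exact η.inChart_pullback hzt hz.1 hz.2

/-- Under the isometry between 1-forms and linear functionals, pullback becomes composition of
continuous linear maps, which is smooth in both arguments. -/
theorem contDiffWithinAt_compContinuousLinearMap {X : Type*} [NormedAddCommGroup X]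
    [NormedSpace ℝ X] {a : X → E' [⋀^Fin 1]→L[ℝ] ℝ} {A : X → E →L[ℝ] E'} {s : Set X} {x : X}
    {n : ℕ∞ω}
    (ha : ContDiffWithinAt ℝ n a s x) (hA : ContDiffWithinAt ℝ n A s x) :
    ContDiffWithinAt ℝ n (fun y => (a y).compContinuousLinearMap (A y)) s x := by
  let e := ContinuousAlternatingMap.ofSubsingletonLIE (𝕜 := ℝ) (E := E) (F := ℝ) (0 : Fin 1)
  let e' := ContinuousAlternatingMap.ofSubsingletonLIE (𝕜 := ℝ) (E := E') (F := ℝ) (0 : Fin 1)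
  have h : ∀ y, (a y).compContinuousLinearMap (A y) = e ((e'.symm (a y)).comp (A y)) := by
    intro y
    ext v
    change a y _ = a y _
    congr 1
    funext i
    rw [Subsingleton.elim i 0]
  simp_rw [h]
  exact e.contDiff.contDiffAt.comp_contDiffWithinAt x
    ((e'.symm.contDiff.contDiffAt.comp_contDiffWithinAt x ha).clm_comp hA)

theorem contDiffWithinAt_inChart_pullback {η : DForm I' M' 1} {F : M → M'} {x₀ x : M} {y₀ : M'}
    (hx : x ∈ (extChartAt I x₀).source) (hF : ContMDiffAt I I' ∞ F x)
    (hy : F x ∈ (extChartAt I' y₀).source)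
    (hη : ContDiffWithinAt ℝ ∞ (η.inChart y₀) (range I') (extChartAt I' y₀ (F x))) :
    ContDiffWithinAt ℝ ∞ ((DForm.pullback I F η).inChart x₀) (range I) (extChartAt I x₀ x) := by
  have hF' := ((contMDiffAt_iff_of_mem_source (by rwa [← extChartAt_source I])
    (by rwa [← extChartAt_source I'])).1 hF).2
  have hxr : extChartAt I x₀ x ∈ range I := mem_range_self _
  refine ContDiffWithinAt.congr_of_eventuallyEq_of_mem ?_
    (eventually_inChart_pullback η hx hF hy) hxr
  refine contDiffWithinAt_compContinuousLinearMap ?_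
    (hF'.fderivWithin_right I.uniqueDiffOn (by simp) hxr)
  refine ContDiffWithinAt.comp (g := η.inChart y₀) (t := range I') _ ?_ hF' (fun z _ => mem_range_self _)
  simpa only [Function.comp_apply, (extChartAt I x₀).left_inv hx] using hη

/-- A change of chart is pullback along the identity, read in two different charts. -/
theorem DForm.SmoothAt.inChart {η : DForm I M 1} {x x₀ : M} (h : η.SmoothAt x)
    (hx : x ∈ (extChartAt I x₀).source) :
    ContDiffWithinAt ℝ ∞ (η.inChart x₀) (range I) (extChartAt I x₀ x) := by
  have := contDiffWithinAt_inChart_pullback (F := id) (η := η) hx contMDiffAt_id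
    (mem_extChartAt_source x) h
  rwa [DForm.pullback_id] at this

theorem DForm.isSmooth_iff {η : DForm I M 1} : η.IsSmooth ↔ ∀ x, η.SmoothAt x := by
  constructor
  · intro h x
    exact (h x _ (mem_extChartAt_target x)).mono_of_mem_nhdsWithin
      (extChartAt_target_mem_nhdsWithin x)
  · intro h x₀ z hz
    have := (h _).inChart ((extChartAt I x₀).map_target hz)
    rw [(extChartAt I x₀).right_inv hz] at this
    exact this.mono (extChartAt_target_subset_range x₀)

theorem DForm.SmoothAt.pullback {η : DForm I' M' 1} {F : M → M'} {x : M}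
    (h : η.SmoothAt (F x)) (hF : ContMDiffAt I I' ∞ F x) :
    (DForm.pullback I F η).SmoothAt x :=
  contDiffWithinAt_inChart_pullback (mem_extChartAt_source x) hF (mem_extChartAt_source _) h

/-- In charts, the exterior derivative commutes with pullback. -/
theorem extDerivWithin_inChart_pullback {η : DForm I' M' k} {F : M → M'} {x₀ x : M} {y₀ : M'}
    (hx : x ∈ (extChartAt I x₀).source) (hF : ContMDiffAt I I' ∞ F x)
    (hy : F x ∈ (extChartAt I' y₀).source)
    (hη : ContDiffWithinAt ℝ ∞ (η.inChart y₀) (range I') (extChartAt I' y₀ (F x))) :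
    extDerivWithin ((DForm.pullback I F η).inChart x₀) (range I) (extChartAt I x₀ x) =
      (extDerivWithin (η.inChart y₀) (range I')
        (extChartAt I' y₀ (F x))).compContinuousLinearMap
        (fderivWithin ℝ (extChartAt I' y₀ ∘ F ∘ (extChartAt I x₀).symm) (range I)
          (extChartAt I x₀ x)) := by
  have hF' := ((contMDiffAt_iff_of_mem_source (by rwa [← extChartAt_source I])
    (by rwa [← extChartAt_source I'])).1 hF).2
  have hxr : extChartAt I x₀ x ∈ range I := mem_range_self _
  have hp : (extChartAt I' y₀ ∘ F ∘ (extChartAt I x₀).symm) (extChartAt I x₀ x) =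
      extChartAt I' y₀ (F x) := by
    simp only [Function.comp_apply, (extChartAt I x₀).left_inv hx]
  -- At boundary points, d commutes with pullback because second derivatives are symmetric. This
  -- uses C² regularity and the fact that `range I` lies in the closure of its interior.
  rw [(eventually_inChart_pullback η hx hF hy).extDerivWithin_eq_of_mem hxr,
    extDerivWithin_pullback (t := range I') _ hF' (by simpa using WithTop.coe_le_coe.2 (le_top : (2 : ℕ∞) ≤ ⊤)) I.uniqueDiffOn
      (I.range_subset_closure_interior hxr) hxr (fun z _ => mem_range_self _), hp]
  rw [hp]
  exact hη.differentiableWithinAt (by simp)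

/-- Converts identities between coordinate expressions into identities on tangent spaces, where
`DForm.d` takes its values. -/
theorem mfderiv_eq_fderivWithin_extChartAt {F : M → M'} {x₀ x : M} {y₀ : M'}
    (hx : x ∈ (extChartAt I x₀).source) (hF : MDifferentiableAt I I' F x)
    (hy : F x ∈ (extChartAt I' y₀).source) :
    (mfderiv I' 𝓘(ℝ, E') (extChartAt I' y₀) (F x)).comp (mfderiv I I' F x) =
      (fderivWithin ℝ (extChartAt I' y₀ ∘ F ∘ (extChartAt I x₀).symm) (range I)
        (extChartAt I x₀ x)).comp (mfderiv I 𝓘(ℝ, E) (extChartAt I x₀) x) := by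
  have : IsManifold I 1 M := .of_le (n := ∞) (by simp)
  have : IsManifold I' 1 M' := .of_le (n := ∞) (by simp)
  have hxc : x ∈ (chartAt H x₀).source := by rwa [← extChartAt_source (I := I)]
  have hyc : F x ∈ (chartAt H' y₀).source := by rwa [← extChartAt_source (I := I')]
  have hxt : extChartAt I x₀ x ∈ (extChartAt I x₀).target := (extChartAt I x₀).map_source hx
  have hl := (extChartAt I x₀).left_inv hx
  have hFs : MDifferentiableWithinAt 𝓘(ℝ, E) I' (F ∘ (extChartAt I x₀).symm) (range I)
      (extChartAt I x₀ x) :=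
    MDifferentiableAt.comp_mdifferentiableWithinAt _ (by rwa [hl])
      (mdifferentiableWithinAt_extChartAt_symm hxt)
  have hg : MDifferentiableWithinAt 𝓘(ℝ, E) 𝓘(ℝ, E')
      (extChartAt I' y₀ ∘ F ∘ (extChartAt I x₀).symm) (range I) (extChartAt I x₀ x) :=
    MDifferentiableAt.comp_mdifferentiableWithinAt _
      (mdifferentiableAt_extChartAt (by simpa only [Function.comp_apply, hl] using hyc)) hFs
  rw [← mfderiv_comp x (mdifferentiableAt_extChartAt hyc) hF, ← mfderivWithin_eq_fderivWithin,
    ← mfderivWithin_univ, ← mfderivWithin_univ]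
  refine Eq.trans ?_ (mfderivWithin_comp (u := range I) x hg
    (mdifferentiableAt_extChartAt hxc).mdifferentiableWithinAt (fun z _ => mem_range_self _)
    (uniqueMDiffWithinAt_univ I))
  rw [mfderivWithin_univ, mfderivWithin_univ]
  refine Filter.EventuallyEq.mfderiv_eq ?_
  filter_upwards [(isOpen_extChartAt_source x₀).mem_nhds hx] with x' hx'
  simp only [Function.comp_apply, (extChartAt I x₀).left_inv hx']

/-- Chart independence of d: naturality under the identity map, with different charts on the two
sides. -/
theorem DForm.d_eq_of_mem_source {η : DForm I M 1} {x₀ x : M} (h : η.SmoothAt x)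
    (hx : x ∈ (extChartAt I x₀).source) :
    η.d x = (extDerivWithin (η.inChart x₀) (range I)
      (extChartAt I x₀ x)).compContinuousLinearMap
        (mfderiv I 𝓘(ℝ, E) (extChartAt I x₀) x) := by
  have h1 := extDerivWithin_inChart_pullback (F := id) (η := η) (mem_extChartAt_source (I := I) x)
    contMDiffAt_id hx (h.inChart hx)
  have h2 := mfderiv_eq_fderivWithin_extChartAt (F := id) (mem_extChartAt_source (I := I) x)
    mdifferentiableAt_id hx
  rw [DForm.pullback_id] at h1
  unfold DForm.d
  rw [h1]
  change ContinuousAlternatingMap.compContinuousLinearMap _ (ContinuousLinearMap.comp _ _) = _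
  erw [← h2, mfderiv_id]
  rfl

theorem DForm.d_pullback {η : DForm I' M' 1} {F : M → M'} {x : M}
    (h : η.SmoothAt (F x)) (hF : ContMDiffAt I I' ∞ F x) :
    (DForm.pullback I F η).d x = DForm.pullback I F η.d x := by
  have h1 := extDerivWithin_inChart_pullback (F := F) (η := η) (mem_extChartAt_source (I := I) x)
    hF (mem_extChartAt_source (I := I') (F x)) h
  have h2 := mfderiv_eq_fderivWithin_extChartAt (F := F) (mem_extChartAt_source (I := I) x)
    (hF.mdifferentiableAt (by simp)) (mem_extChartAt_source (I := I') (F x))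
  unfold DForm.d
  rw [h1]
  change ContinuousAlternatingMap.compContinuousLinearMap _ (ContinuousLinearMap.comp _ _) = _
  erw [← h2]
  rfl

end FormCalculus

/-! ### Linearity of d, products with functions, and d ∘ d = 0 on functions. -/

section FormAlgebra

variable {E : Type*} [NormedAddCommGroup E] [NormedSpace ℝ E]
  {H : Type*} [TopologicalSpace H]
  {E' : Type*} [NormedAddCommGroup E'] [NormedSpace ℝ E']
  {H' : Type*} [TopologicalSpace H']
  {I : ModelWithCorners ℝ E H} {I' : ModelWithCorners ℝ E' H'}
  {M : Type*} [TopologicalSpace M] [ChartedSpace H M]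
  {M' : Type*} [TopologicalSpace M'] [ChartedSpace H' M'] {k : ℕ}

theorem DForm.inChart_add (η ζ : DForm I M k) (x₀ : M) :
    (η + ζ).inChart x₀ = η.inChart x₀ + ζ.inChart x₀ := rfl

theorem DForm.inChart_smul (c : ℝ) (η : DForm I M k) (x₀ : M) :
    (c • η).inChart x₀ = c • η.inChart x₀ := rfl

theorem tendsto_extChartAt_symm (x : M) :
    Filter.Tendsto (extChartAt I x).symm (𝓝[range I] (extChartAt I x x)) (𝓝 x) := by
  have := (continuousAt_extChartAt_symm (I := I) x).tendsto
  rw [(extChartAt I x).left_inv (mem_extChartAt_source x)] at this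
  exact this.mono_left nhdsWithin_le_nhds

theorem DForm.inChart_eventuallyEq {η ζ : DForm I M k} {x : M} (h : ∀ᶠ y in 𝓝 x, η y = ζ y) :
    η.inChart x =ᶠ[𝓝[range I] (extChartAt I x x)] ζ.inChart x := by
  filter_upwards [(tendsto_extChartAt_symm x).eventually h] with z hz
  simp only [DForm.inChart, hz]

theorem DForm.SmoothAt.congr {η ζ : DForm I M k} {x : M} (hη : η.SmoothAt x)
    (h : ∀ᶠ y in 𝓝 x, ζ y = η y) : ζ.SmoothAt x :=
  ContDiffWithinAt.congr_of_eventuallyEq_of_mem hη (DForm.inChart_eventuallyEq h)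
    (mem_range_self _)

theorem DForm.SmoothAt.add {η ζ : DForm I M k} {x : M} (hη : η.SmoothAt x) (hζ : ζ.SmoothAt x) :
    (η + ζ).SmoothAt x :=
  ContDiffWithinAt.add hη hζ

theorem DForm.smoothAt_zero (x : M) : (0 : DForm I M k).SmoothAt x := by
  have h : (0 : DForm I M k).inChart x = fun _ => 0 := rfl
  unfold DForm.SmoothAt
  rw [h]
  exact contDiffWithinAt_const

theorem DForm.SmoothAt.const_smul {η : DForm I M k} {x : M} (c : ℝ) (hη : η.SmoothAt x) :
    (c • η).SmoothAt x :=
  ContDiffWithinAt.const_smul c hη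

theorem DForm.SmoothAt.sum {ι : Type*} {η : ι → DForm I M k} {x : M} (s : Finset ι)
    (h : ∀ i ∈ s, (η i).SmoothAt x) : (∑ i ∈ s, η i).SmoothAt x := by
  classical
  induction s using Finset.induction_on with
  | empty => simpa using DForm.smoothAt_zero x
  | insert a s ha ih =>
    rw [Finset.sum_insert ha]
    exact (h a (by simp)).add (ih fun i hi => h i (by simp [hi]))

theorem DForm.d_add {η ζ : DForm I M k} {x : M} (hη : η.SmoothAt x) (hζ : ζ.SmoothAt x) :
    (η + ζ).d x = η.d x + ζ.d x := by
  have hu : UniqueDiffWithinAt ℝ (range I) (extChartAt I x x) :=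
    I.uniqueDiffOn _ (mem_range_self _)
  unfold DForm.d
  rw [DForm.inChart_add, extDerivWithin_add hu
    (ContDiffWithinAt.differentiableWithinAt hη (by simp))
    (ContDiffWithinAt.differentiableWithinAt hζ (by simp))]
  rfl

theorem DForm.d_smul (c : ℝ) (η : DForm I M k) (x : M) : (c • η).d x = c • η.d x := by
  have hu : UniqueDiffWithinAt ℝ (range I) (extChartAt I x x) :=
    I.uniqueDiffOn _ (mem_range_self _)
  unfold DForm.d
  rw [DForm.inChart_smul, extDerivWithin_smul _ _ hu]
  rfl

theorem DForm.SmoothAt.smul {η : DForm I M k} {g : M → ℝ} {x : M} (hη : η.SmoothAt x)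
    (hg : ContMDiffAt I 𝓘(ℝ, ℝ) ∞ g x) : DForm.SmoothAt (fun p => g p • η p : DForm I M k) x := by
  have h : DForm.inChart (fun p => g p • η p : DForm I M k) x =
      fun z => (g ∘ (extChartAt I x).symm) z • η.inChart x z := rfl
  unfold DForm.SmoothAt
  rw [h]
  exact ContDiffWithinAt.smul ((contMDiffAt_iff.1 hg).2) hη

theorem pullback_differential {h : M' → ℝ} {F : M → M'} {x : M}
    (hh : MDifferentiableAt I' 𝓘(ℝ, ℝ) h (F x)) (hF : MDifferentiableAt I I' F x) :
    DForm.pullback I F (differential I' h) x = differential I (h ∘ F) x := by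
  ext v
  exact (DFunLike.congr_fun (mfderiv_comp x hh hF) (v 0)).symm

variable [IsManifold I ∞ M]

theorem differential_inChart {h : M → ℝ} {x₀ : M} {z : E} (hz : z ∈ (extChartAt I x₀).target)
    (hh : MDifferentiableAt I 𝓘(ℝ, ℝ) h ((extChartAt I x₀).symm z)) :
    (differential I h).inChart x₀ z = ContinuousAlternatingMap.ofSubsingleton ℝ E ℝ (0 : Fin 1)
      (fderivWithin ℝ (h ∘ (extChartAt I x₀).symm) (range I) z) := by
  have : IsManifold I 1 M := .of_le (n := ∞) (by simp)
  have hzr : z ∈ range I := extChartAt_target_subset_range x₀ hz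
  rw [← mfderivWithin_eq_fderivWithin, mfderiv_comp_mfderivWithin z hh
    (mdifferentiableWithinAt_extChartAt_symm (I := I) hz) (I.uniqueMDiffOn z hzr)]
  rfl

theorem eventually_differential_inChart {h : M → ℝ} (hh : ContMDiff I 𝓘(ℝ, ℝ) ∞ h) (x : M) :
    (differential I h).inChart x =ᶠ[𝓝[range I] (extChartAt I x x)]
      fun z => ContinuousAlternatingMap.ofSubsingleton ℝ E ℝ (0 : Fin 1)
        (fderivWithin ℝ (h ∘ (extChartAt I x).symm) (range I) z) := by
  filter_upwards [extChartAt_target_mem_nhdsWithin x] with z hz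
  exact differential_inChart hz (hh.mdifferentiable (by simp) _)

theorem smoothAt_differential {h : M → ℝ} (hh : ContMDiff I 𝓘(ℝ, ℝ) ∞ h) (x : M) :
    (differential I h).SmoothAt x := by
  refine ContDiffWithinAt.congr_of_eventuallyEq_of_mem ?_ (eventually_differential_inChart hh x)
    (mem_range_self _)
  let e := ContinuousAlternatingMap.ofSubsingletonLIE (𝕜 := ℝ) (E := E) (F := ℝ) (0 : Fin 1)
  exact e.contDiff.contDiffAt.comp_contDiffWithinAt _
    (ContDiffWithinAt.fderivWithin_right (contMDiffAt_iff.1 (hh x)).2 I.uniqueDiffOn (by simp)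
      (mem_range_self _))

/-- In coordinates dh is the exterior derivative of a 0-form, so the vector space identity d ∘ d = 0
applies. -/
theorem d_differential {h : M → ℝ} (hh : ContMDiff I 𝓘(ℝ, ℝ) ∞ h) (x : M) :
    (differential I h).d x = 0 := by
  have h1 : (differential I h).inChart x =ᶠ[𝓝[range I] (extChartAt I x x)]
      extDerivWithin (fun z => ContinuousAlternatingMap.constOfIsEmpty ℝ E (Fin 0)
        ((h ∘ (extChartAt I x).symm) z)) (range I) := by
    filter_upwards [eventually_differential_inChart hh x, self_mem_nhdsWithin] with z hz hzr
    rw [hz, extDerivWithin_constOfIsEmpty _ (I.uniqueDiffOn z hzr)]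
  have h2 : ContDiffWithinAt ℝ ∞ (fun z => ContinuousAlternatingMap.constOfIsEmpty ℝ E (Fin 0)
        ((h ∘ (extChartAt I x).symm) z)) (range I) (extChartAt I x x) := by
    let e := ContinuousAlternatingMap.constOfIsEmptyLIE ℝ E ℝ (Fin 0)
    exact e.contDiff.contDiffAt.comp_contDiffWithinAt _ (contMDiffAt_iff.1 (hh x)).2
  have hxr : extChartAt I x x ∈ range I := mem_range_self _
  unfold DForm.d
  rw [h1.extDerivWithin_eq_of_mem hxr, extDerivWithin_extDerivWithin_apply h2
    (by simpa using WithTop.coe_le_coe.2 (le_top : (2 : ℕ∞) ≤ ⊤)) I.uniqueDiffOn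
    (I.range_subset_closure_interior hxr) hxr]
  rfl

end FormAlgebra

/-! ### Wedge powers as sums over permutations. -/

section ExteriorAlgebra

variable {V : Type*} [AddCommGroup V] [Module ℝ V] {k l : ℕ}

/-- The product of real-valued multilinear maps in separate blocks of variables. -/
def blockProd (a : MultilinearMap ℝ (fun _ : Fin k => V) ℝ)
    (b : MultilinearMap ℝ (fun _ : Fin l => V) ℝ) :
    MultilinearMap ℝ (fun _ : Fin (k + l) => V) ℝ :=
  ((LinearMap.mul' ℝ ℝ).compMultilinearMap (MultilinearMap.domCoprod a b)).domDomCongr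
    finSumFinEquiv

theorem blockProd_apply (a : MultilinearMap ℝ (fun _ : Fin k => V) ℝ)
    (b : MultilinearMap ℝ (fun _ : Fin l => V) ℝ) (v : Fin (k + l) → V) :
    blockProd a b v = a (fun i => v (Fin.castAdd l i)) * b (fun i => v (Fin.natAdd k i)) := by
  simp [blockProd]

/-- Conjugation by the reindexing matches the two sums over permutations and preserves signs. -/
theorem alternatization_domDomCongr {ι κ : Type*} [Fintype ι] [DecidableEq ι] [Fintype κ]
    [DecidableEq κ] (e : ι ≃ κ) (m : MultilinearMap ℝ (fun _ : ι => V) ℝ) :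
    MultilinearMap.alternatization (m.domDomCongr e) =
      (MultilinearMap.alternatization m).domDomCongr e := by
  ext v
  simp only [MultilinearMap.alternatization_apply, AlternatingMap.domDomCongr_apply]
  refine Fintype.sum_equiv e.symm.permCongr _ _ fun σ => ?_
  simp [Equiv.permCongr_apply]

/-- Every permutation is a shuffle times a permutation within the two blocks; summing over shuffles
of the alternatizations therefore runs through all permutations once, without factorials. -/
theorem wedge_alternatization (a : MultilinearMap ℝ (fun _ : Fin k => V) ℝ)
    (b : MultilinearMap ℝ (fun _ : Fin l => V) ℝ) :
    wedge (MultilinearMap.alternatization a) (MultilinearMap.alternatization b) =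
      MultilinearMap.alternatization (blockProd a b) := by
  rw [wedge, blockProd, alternatization_domDomCongr, LinearMap.compMultilinearMap_alternatization,
    MultilinearMap.domCoprod_alternization]

theorem wedge_smul (c d : ℝ) (a : V [⋀^Fin k]→ₗ[ℝ] ℝ) (b : V [⋀^Fin l]→ₗ[ℝ] ℝ) :
    wedge (c • a) (d • b) = (c * d) • wedge a b := by
  simp only [wedge, ← AlternatingMap.domCoprod'_apply, TensorProduct.smul_tmul_smul, map_smul]
  ext v
  simp

theorem wedge_add_left (a a' : V [⋀^Fin k]→ₗ[ℝ] ℝ) (b : V [⋀^Fin l]→ₗ[ℝ] ℝ) :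
    wedge (a + a') b = wedge a b + wedge a' b := by
  simp only [wedge, ← AlternatingMap.domCoprod'_apply, TensorProduct.add_tmul, map_add]
  ext v
  simp

/-- The multilinear map `(v₀, v₁, …) ↦ ζ(v₀, v₁) ζ(v₂, v₃) ⋯`. -/
def pairProd (ζ : V [⋀^Fin 2]→ₗ[ℝ] ℝ) : (m : ℕ) → MultilinearMap ℝ (fun _ : Fin (2 * m) => V) ℝ
  | 0 => MultilinearMap.constOfIsEmpty ℝ (fun _ : Fin 0 => V) 1
  | m + 1 => blockProd (pairProd ζ m) (ζ : MultilinearMap ℝ (fun _ : Fin 2 => V) ℝ)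

theorem pairProd_apply (ζ : V [⋀^Fin 2]→ₗ[ℝ] ℝ) (m : ℕ) (v : Fin (2 * m) → V) :
    pairProd ζ m v =
      ∏ i : Fin m, ζ ![v ⟨2 * i, by omega⟩, v ⟨2 * i + 1, by omega⟩] := by
  induction m with
  | zero => simp [pairProd]
  | succ m ih =>
    rw [Fin.prod_univ_castSucc]
    refine (blockProd_apply (pairProd ζ m) (ζ : MultilinearMap ℝ (fun _ : Fin 2 => V) ℝ) v).trans ?_
    rw [ih]
    refine congrArg₂ (· * ·) rfl ?_
    change ζ _ = ζ _
    congr 1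
    funext i
    fin_cases i <;> rfl

/-- An alternating 2-form is half its own alternatization, and each factor contributes one such
half. -/
theorem wedgePow_eq (ζ : V [⋀^Fin 2]→ₗ[ℝ] ℝ) (m : ℕ) :
    wedgePow ζ m = ((1 / 2 : ℝ) ^ m) • MultilinearMap.alternatization (pairProd ζ m) := by
  induction m with
  | zero =>
    ext v
    simp [wedgePow, pairProd, MultilinearMap.alternatization_apply]
  | succ m ih =>
    have h : ζ = (1 / 2 : ℝ) •
        MultilinearMap.alternatization (ζ : MultilinearMap ℝ (fun _ : Fin 2 => V) ℝ) := by
      rw [AlternatingMap.coe_alternatization]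
      ext v
      simp
    change wedge (wedgePow ζ m) ζ = _
    conv_lhs => rw [ih]; arg 2; rw [h]
    rw [wedge_smul, wedge_alternatization, pow_succ]
    rfl

/-- The expansion of `a ∧ ζⁿ` over permutations. -/
theorem wedge_wedgePow_apply (a : V [⋀^Fin 1]→ₗ[ℝ] ℝ) (ζ : V [⋀^Fin 2]→ₗ[ℝ] ℝ) (n : ℕ)
    (v : Fin (1 + 2 * n) → V) :
    wedge a (wedgePow ζ n) v = (1 / 2 : ℝ) ^ n * ∑ σ : Equiv.Perm (Fin (1 + 2 * n)),
      (Equiv.Perm.sign σ : ℝ) * (a ![v (σ (Fin.castAdd _ 0))] *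
        ∏ i : Fin n, ζ ![v (σ (Fin.natAdd 1 ⟨2 * i, by omega⟩)),
          v (σ (Fin.natAdd 1 ⟨2 * i + 1, by omega⟩))]) := by
  have h : a = (1 : ℝ) •
      MultilinearMap.alternatization (a : MultilinearMap ℝ (fun _ : Fin 1 => V) ℝ) := by
    rw [AlternatingMap.coe_alternatization]
    simp
  conv_lhs => rw [wedgePow_eq, h]
  rw [wedge_smul, wedge_alternatization, one_mul, AlternatingMap.smul_apply,
    MultilinearMap.alternatization_apply, smul_eq_mul]
  congr 1
  refine Finset.sum_congr rfl fun σ _ => ?_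
  rw [MultilinearMap.domDomCongr_apply, blockProd_apply, pairProd_apply, Units.smul_def,
    zsmul_eq_mul]
  congr 2
  change a _ = a _
  congr 1
  funext i
  fin_cases i; rfl

/-- Naturality is visible in the permutation expansion, where A only acts on the arguments. -/
theorem wedge_wedgePow_compLinearMap {W : Type*} [AddCommGroup W] [Module ℝ W]
    (a : V [⋀^Fin 1]→ₗ[ℝ] ℝ) (ζ : V [⋀^Fin 2]→ₗ[ℝ] ℝ) (n : ℕ) (A : W →ₗ[ℝ] V) :
    wedge (a.compLinearMap A) (wedgePow (ζ.compLinearMap A) n) =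
      (wedge a (wedgePow ζ n)).compLinearMap A := by
  ext v
  rw [AlternatingMap.compLinearMap_apply, wedge_wedgePow_apply, wedge_wedgePow_apply]
  simp only [AlternatingMap.compLinearMap_apply]
  congr 1
  refine Finset.sum_congr rfl fun σ _ => ?_
  congr 2
  · congr 1
    funext i
    fin_cases i; rfl
  · refine Finset.prod_congr rfl fun i _ => ?_
    congr 1
    funext j
    fin_cases j <;> rfl

end ExteriorAlgebra

/-! ### Symplectic bases and nonvanishing of a ∧ ζⁿ. -/

section SymplecticLinearAlgebra

/-- A family of vectors in which `ζ` has the matrix of the standard symplectic form. -/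
def IsSymplecticFamily {V : Type*} [AddCommGroup V] [Module ℝ V] (ζ : V [⋀^Fin 2]→ₗ[ℝ] ℝ) {n : ℕ}
    (w : Fin n × Fin 2 → V) : Prop :=
  (∀ i, ζ ![w (i, 0), w (i, 1)] = 1) ∧ ∀ p q : Fin n × Fin 2, p.1 ≠ q.1 → ζ ![w p, w q] = 0

/-- A permutation respecting the division into pairs permutes the pairs and flips some of them.
Permuting whole pairs moves both columns by the same ρ, so it contributes (sign ρ)² = 1. -/
theorem exists_perm_prod_of_fst_eq {n : ℕ} (τ : Equiv.Perm (Fin n × Fin 2))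
    (h : ∀ i, (τ (i, 0)).1 = (τ (i, 1)).1) :
    ∃ (ρ : Equiv.Perm (Fin n)) (s : Fin n → Equiv.Perm (Fin 2)),
      (∀ i a, τ (i, a) = (ρ i, s i a)) ∧ Equiv.Perm.sign τ = ∏ i, Equiv.Perm.sign (s i) := by
  have h1 : ∀ i a, (τ (i, a)).1 = (τ (i, 0)).1 := by
    intro i a
    fin_cases a
    · rfl
    · exact (h i).symm
  have hs : ∀ i, Function.Bijective fun a => (τ (i, a)).2 := fun i =>
    Finite.injective_iff_bijective.1 fun a b hab => by
      have := τ.injective (Prod.ext ((h1 i a).trans (h1 i b).symm) hab)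
      exact (Prod.mk.inj this).2
  have hρ : Function.Bijective fun i => (τ (i, 0)).1 :=
    Finite.injective_iff_bijective.1 fun i j hij => by
      obtain ⟨a, ha⟩ := (hs i).2 (τ (j, 0)).2
      have := τ.injective (Prod.ext ((h1 i a).trans hij) ha)
      exact (Prod.mk.inj this).1
  let ρ := Equiv.ofBijective _ hρ
  let s := fun i => Equiv.ofBijective _ (hs i)
  have hτ : ∀ i a, τ (i, a) = (ρ i, s i a) := fun i a => Prod.ext (h1 i a) rfl
  refine ⟨ρ, s, hτ, ?_⟩
  have hmul : τ = Equiv.prodCongrLeft (fun _ : Fin 2 => ρ) * Equiv.prodCongrRight s := by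
    ext1 ⟨i, a⟩
    rw [hτ]
    rfl
  rw [hmul, Equiv.Perm.sign_mul, Equiv.Perm.sign_prodCongrLeft, Equiv.Perm.sign_prodCongrRight]
  simp

theorem IsSymplecticFamily.apply_perm {V : Type*} [AddCommGroup V] [Module ℝ V]
    {ζ : V [⋀^Fin 2]→ₗ[ℝ] ℝ} {n : ℕ} {w : Fin n × Fin 2 → V} (hw : IsSymplecticFamily ζ w)
    (i : Fin n) (s : Equiv.Perm (Fin 2)) :
    ζ ![w (i, s 0), w (i, s 1)] = (Equiv.Perm.sign s : ℝ) := by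
  have h : ![w (i, s 0), w (i, s 1)] = ![w (i, 0), w (i, 1)] ∘ s := by
    have : ∀ a, ![w (i, 0), w (i, 1)] a = w (i, a) := by
      intro a
      fin_cases a <;> rfl
    funext a
    rw [Function.comp_apply, this]
    fin_cases a <;> rfl
  rw [h, AlternatingMap.map_perm, hw.1, Units.smul_def, zsmul_one]

/-- If τ respects the pairs, each flip enters once through the sign of τ and once through ζ, giving
a square. Otherwise some factor pairs vectors of different planes and vanishes. -/
theorem IsSymplecticFamily.sign_mul_prod {V : Type*} [AddCommGroup V] [Module ℝ V]
    {ζ : V [⋀^Fin 2]→ₗ[ℝ] ℝ} {n : ℕ} {w : Fin n × Fin 2 → V} (hw : IsSymplecticFamily ζ w)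
    (τ : Equiv.Perm (Fin n × Fin 2)) :
    0 ≤ (Equiv.Perm.sign τ : ℝ) * ∏ i, ζ ![w (τ (i, 0)), w (τ (i, 1))] := by
  by_cases h : ∀ i, (τ (i, 0)).1 = (τ (i, 1)).1
  · obtain ⟨ρ, s, hτ, hsign⟩ := exists_perm_prod_of_fst_eq τ h
    simp only [hτ, hw.apply_perm, hsign]
    push_cast
    rw [← Finset.prod_mul_distrib]
    exact Finset.prod_nonneg fun i _ => mul_self_nonneg _
  · push Not at h
    obtain ⟨i, hi⟩ := h
    rw [Finset.prod_eq_zero (Finset.mem_univ i) (hw.2 _ _ hi), mul_zero]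

/-- Evaluated on v₀ followed by the family, every term of the expansion is zero or has the sign of
a(v₀), and the identity permutation contributes a nonzero term. Hence no cancellation is possible.
-/
theorem wedge_wedgePow_ne_zero_of_symplecticFamily {V : Type*} [AddCommGroup V] [Module ℝ V]
    {a : V [⋀^Fin 1]→ₗ[ℝ] ℝ} {ζ : V [⋀^Fin 2]→ₗ[ℝ] ℝ} {n : ℕ} {w : Fin n × Fin 2 → V}
    (hw : IsSymplecticFamily ζ w) (ha : ∀ p, a ![w p] = 0) {v₀ : V} (hv₀ : a ![v₀] ≠ 0) :
    wedge a (wedgePow ζ n) ≠ 0 := by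
  -- The slot of v₀ is position 0; the vector indexed by (i, j) occupies position 1 + 2i + j.
  let e : Fin 1 ⊕ (Fin n × Fin 2) ≃ Fin (1 + 2 * n) :=
    (Equiv.sumCongr (Equiv.refl _) (finProdFinEquiv.trans (finCongr (mul_comm n 2)))).trans
      finSumFinEquiv
  have he0 : Fin.castAdd (2 * n) 0 = e (.inl 0) := rfl
  have he1 : ∀ i : Fin n, Fin.natAdd 1 ⟨2 * i, by omega⟩ = e (.inr (i, 0)) := fun i => by
    ext; simp [e]
  have he2 : ∀ i : Fin n, Fin.natAdd 1 ⟨2 * i + 1, by omega⟩ = e (.inr (i, 1)) := fun i => by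
    ext; simp [e]; omega
  let u : Fin 1 ⊕ (Fin n × Fin 2) → V := Sum.elim (fun _ => v₀) w
  let T : Equiv.Perm (Fin 1 ⊕ (Fin n × Fin 2)) → ℝ := fun σ =>
    (Equiv.Perm.sign σ : ℝ) * (a ![u (σ (.inl 0))] *
      ∏ i : Fin n, ζ ![u (σ (.inr (i, 0))), u (σ (.inr (i, 1)))])
  have hsum : wedge a (wedgePow ζ n) (u ∘ e.symm) = (1 / 2 : ℝ) ^ n * ∑ σ, T σ := by
    rw [wedge_wedgePow_apply]
    congr 1
    refine Fintype.sum_equiv e.symm.permCongr _ _ fun σ => ?_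
    simp only [T, Equiv.Perm.sign_permCongr, Equiv.permCongr_apply, he0, he1, he2,
      Function.comp_apply, Equiv.symm_symm]
  have hT : ∀ σ, 0 ≤ (a ![v₀])⁻¹ * T σ := by
    intro σ
    rcases hσ : σ (.inl 0) with j | p
    -- If σ keeps v₀ in the slot of `a`, it is a permutation of the remaining vectors; otherwise `a`
    -- meets a vector of the family, where it vanishes.
    · have hmem : σ ∈ (Equiv.Perm.sumCongrHom (Fin 1) (Fin n × Fin 2)).range := by
        refine Equiv.Perm.mem_sumCongrHom_range_of_perm_mapsTo_inl ?_
        rintro _ ⟨i, rfl⟩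
        rw [Subsingleton.elim i 0, hσ]
        exact mem_range_self _
      obtain ⟨⟨σ₁, τ⟩, rfl⟩ := hmem
      have h1 : σ₁ = 1 := Subsingleton.elim _ _
      have h2 := hw.sign_mul_prod τ
      subst h1
      simp only [T, Equiv.Perm.sumCongrHom_apply, Equiv.Perm.sign_sumCongr, Equiv.Perm.sign_one,
        one_mul, Equiv.Perm.sumCongr_apply, Sum.map_inl, Sum.map_inr, u, Sum.elim_inl,
        Sum.elim_inr]
      rw [mul_left_comm _ (a _), inv_mul_cancel_left₀ hv₀]
      exact h2
    · simp only [T, hσ, u, Sum.elim_inr, ha, zero_mul, mul_zero, le_refl]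
  have hT1 : 0 < (a ![v₀])⁻¹ * T 1 := by
    simp [T, u, hw.1, hv₀]
  have hpos : 0 < ∑ σ, (a ![v₀])⁻¹ * T σ :=
    Finset.sum_pos' (fun σ _ => hT σ) ⟨1, Finset.mem_univ _, hT1⟩
  intro h0
  rw [h0, AlternatingMap.zero_apply, eq_comm, mul_eq_zero] at hsum
  rw [← Finset.mul_sum, hsum.resolve_left (by positivity), mul_zero] at hpos
  exact lt_irrefl _ hpos

theorem map_pair_swap {V : Type*} [AddCommGroup V] [Module ℝ V] (ζ : V [⋀^Fin 2]→ₗ[ℝ] ℝ)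
    (x y : V) : ζ ![y, x] = -ζ ![x, y] := by
  rw [← ζ.map_swap ![x, y] (i := 0) (j := 1) (by simp)]
  congr 1
  funext i
  fin_cases i <;> rfl

/-- The bilinear form underlying an alternating `2`-form. -/
def pairForm {V : Type*} [AddCommGroup V] [Module ℝ V] (ζ : V [⋀^Fin 2]→ₗ[ℝ] ℝ) :
    V →ₗ[ℝ] V →ₗ[ℝ] ℝ :=
  LinearMap.mk₂ ℝ (fun x y => ζ ![x, y]) (fun x x' y => ζ.map_vecCons_add _ _ _)
    (fun c x y => ζ.map_vecCons_smul _ _ _)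
    (fun x y y' => by
      rw [map_pair_swap ζ y x, map_pair_swap ζ y' x, map_pair_swap ζ (y + y') x,
        ζ.map_vecCons_add]
      ring)
    (fun c x y => by
      rw [map_pair_swap ζ y x, map_pair_swap ζ (c • y) x, ζ.map_vecCons_smul]
      simp)

theorem pairForm_apply {V : Type*} [AddCommGroup V] [Module ℝ V] (ζ : V [⋀^Fin 2]→ₗ[ℝ] ℝ)
    (x y : V) : pairForm ζ x y = ζ ![x, y] := rfl

theorem pairForm_self {V : Type*} [AddCommGroup V] [Module ℝ V] (ζ : V [⋀^Fin 2]→ₗ[ℝ] ℝ)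
    (x : V) : pairForm ζ x x = 0 :=
  ζ.map_eq_zero_of_eq ![x, x] (i := 0) (j := 1) rfl (by simp)

theorem pairForm_swap {V : Type*} [AddCommGroup V] [Module ℝ V] (ζ : V [⋀^Fin 2]→ₗ[ℝ] ℝ)
    (x y : V) : pairForm ζ y x = -pairForm ζ x y :=
  map_pair_swap ζ x y

/-- A nondegenerate alternating form on a `2n`-dimensional space has a symplectic basis. -/
theorem exists_isSymplecticFamily (n : ℕ) : ∀ {V : Type*} [AddCommGroup V] [Module ℝ V]
    [FiniteDimensional ℝ V] (ζ : V [⋀^Fin 2]→ₗ[ℝ] ℝ), Module.finrank ℝ V = 2 * n →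
    (∀ x, (∀ y, ζ ![x, y] = 0) → x = 0) → ∃ w : Fin n × Fin 2 → V, IsSymplecticFamily ζ w := by
  induction n with
  | zero => exact fun ζ _ _ => ⟨fun p => p.1.elim0, fun i => i.elim0, fun p => p.1.elim0⟩
  | succ n ih =>
    intro V _ _ _ ζ hdim hnd
    have : Nontrivial V := Module.nontrivial_of_finrank_pos (R := ℝ) (by omega)
    obtain ⟨e, he⟩ := exists_ne (0 : V)
    obtain ⟨f', hf'⟩ : ∃ f, pairForm ζ e f ≠ 0 := by
      by_contra! h
      exact he (hnd e h)
    obtain ⟨f, hf⟩ : ∃ f, pairForm ζ e f = 1 :=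
      ⟨(pairForm ζ e f')⁻¹ • f', by simp [hf']⟩
    have hfe : pairForm ζ f e = -1 := by rw [pairForm_swap, hf]
    -- The kernel of P is the symplectic complement of the plane spanned by e and f, to which the
    -- induction hypothesis applies.
    let P : V →ₗ[ℝ] ℝ × ℝ := (pairForm ζ e).prod (pairForm ζ f)
    have hP : ∀ x, x ∈ LinearMap.ker P ↔ pairForm ζ e x = 0 ∧ pairForm ζ f x = 0 := by
      intro x
      simp [P]
    have hPsurj : LinearMap.range P = ⊤ := by
      rw [LinearMap.range_eq_top]
      rintro ⟨a, b⟩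
      refine ⟨a • f - b • e, ?_⟩
      simp [P, hf, hfe, pairForm_self]
    have hker : Module.finrank ℝ (LinearMap.ker P) = 2 * n := by
      have := LinearMap.finrank_range_add_finrank_ker P
      rw [hPsurj, finrank_top, Module.finrank_prod, Module.finrank_self, hdim] at this
      omega
    obtain ⟨w, hw⟩ := ih (ζ.compLinearMap (LinearMap.ker P).subtype) hker (by
      intro x hx
      refine Subtype.ext (hnd x fun y => ?_)
      -- The symplectic projection of y to the complement. As x is orthogonal to e and f, pairing
      -- with x does not see the correction.
      have hy : y - pairForm ζ e y • f + pairForm ζ f y • e ∈ LinearMap.ker P := by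
        rw [hP]
        simp [hf, hfe, pairForm_self]
      have h1 : pairForm ζ x (y - pairForm ζ e y • f + pairForm ζ f y • e) = 0 := by
        refine Eq.trans ?_ (hx ⟨_, hy⟩)
        rw [AlternatingMap.compLinearMap_apply, pairForm_apply]
        congr 1
        funext i
        fin_cases i <;> rfl
      have hxe := (hP x).1 x.2
      have hex : pairForm ζ x e = 0 := by rw [pairForm_swap, hxe.1, neg_zero]
      have hfx : pairForm ζ x f = 0 := by rw [pairForm_swap, hxe.2, neg_zero]
      rw [← pairForm_apply]
      simpa [hex, hfx] using h1)
    have hsub : ∀ x y : LinearMap.ker P,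
        ζ.compLinearMap (LinearMap.ker P).subtype ![x, y] = pairForm ζ x y := by
      intro x y
      rw [AlternatingMap.compLinearMap_apply, pairForm_apply]
      congr 1
      funext i
      fin_cases i <;> rfl
    have hwk : ∀ p, pairForm ζ e (w p) = 0 ∧ pairForm ζ f (w p) = 0 := fun p =>
      (hP _).1 (w p).2
    refine ⟨fun p => Fin.cases (![e, f] p.2) (fun i => (w (i, p.2) : V)) p.1, ?_, ?_⟩
    · intro i
      refine Fin.cases hf (fun i => ?_) i
      exact (hsub _ _).symm.trans (hw.1 i)
    · rintro ⟨i, a⟩ ⟨j, b⟩ hij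
      rw [← pairForm_apply]
      induction i using Fin.cases with
      | zero =>
        induction j using Fin.cases with
        | zero => exact absurd rfl hij
        | succ j =>
          have := hwk (j, b)
          fin_cases a
          · exact this.1
          · exact this.2
      | succ i =>
        induction j using Fin.cases with
        | zero =>
          have := hwk (i, a)
          rw [pairForm_swap, neg_eq_zero]
          fin_cases b
          · exact this.1
          · exact this.2
        | succ j =>
          refine (hsub _ _).symm.trans (hw.2 (i, a) (j, b) fun h => hij ?_)
          exact congrArg Fin.succ h

/-- If `ζ` is nondegenerate on a `2n`-dimensional space on which the nonzero form `a` vanishes,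
then `a ∧ ζⁿ ≠ 0`. -/
theorem wedge_wedgePow_ne_zero {V W : Type*} [AddCommGroup V] [Module ℝ V] [AddCommGroup W]
    [Module ℝ W] [FiniteDimensional ℝ W] {a : V [⋀^Fin 1]→ₗ[ℝ] ℝ} {ζ : V [⋀^Fin 2]→ₗ[ℝ] ℝ} {n : ℕ}
    (A : W →ₗ[ℝ] V) (hW : Module.finrank ℝ W = 2 * n)
    (hnd : ∀ x, (∀ y, ζ ![A x, A y] = 0) → x = 0) (ha : ∀ x, a ![A x] = 0)
    {v₀ : V} (hv₀ : a ![v₀] ≠ 0) : wedge a (wedgePow ζ n) ≠ 0 := by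
  have hA : ∀ x y, ζ.compLinearMap A ![x, y] = ζ ![A x, A y] := by
    intro x y
    rw [AlternatingMap.compLinearMap_apply]
    congr 1
    funext i
    fin_cases i <;> rfl
  obtain ⟨w, hw⟩ := exists_isSymplecticFamily n (ζ.compLinearMap A) hW fun x hx =>
    hnd x fun y => (hA x y).symm.trans (hx y)
  refine wedge_wedgePow_ne_zero_of_symplecticFamily (w := A ∘ w)
    ⟨fun i => (hA _ _).symm.trans (hw.1 i), fun p q hpq => (hA _ _).symm.trans (hw.2 p q hpq)⟩
    (fun p => ha _) hv₀

end SymplecticLinearAlgebra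

/-! ### Branches of the angle on the circle and the form dθ. -/

section CircleAngle

/-- The parametrization `t ↦ exp(2πit)` of the circle. -/
def turn (t : ℝ) : Circle := Circle.exp (2 * Real.pi * t)

theorem turn_eq_turn {s t : ℝ} : turn s = turn t ↔ ∃ m : ℤ, s = t + m := by
  have hpi : (2 * Real.pi : ℝ) ≠ 0 := by positivity
  rw [turn, turn, Circle.exp_eq_exp]
  refine exists_congr fun m => ⟨fun h => mul_left_cancel₀ hpi (by rw [h]; ring), ?_⟩
  rintro rfl
  ring

theorem turn_add (s t : ℝ) : turn (s + t) = turn s * turn t := by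
  rw [turn, mul_add, Circle.exp_add]
  rfl

theorem contMDiff_turn : ContMDiff 𝓘(ℝ, ℝ) (𝓡 1) ∞ turn :=
  contMDiff_circleExp.comp ((contDiff_const.mul contDiff_id).contMDiff)

theorem contMDiff_circle_coe : ContMDiff (𝓡 1) 𝓘(ℝ, ℂ) ∞ (fun z : Circle => (z : ℂ)) := by
  have := finrank_real_complex_fact'
  exact contMDiff_coe_sphere (E := ℂ) (n := 1)

/-- The angle of a point of the circle, normalized to lie in `(c - 1/2, c + 1/2]`. -/
def angleLift (c : ℝ) (z : Circle) : ℝ :=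
  c + Complex.arg ((z * turn (-c) : Circle) : ℂ) / (2 * Real.pi)

theorem turn_angleLift (c : ℝ) (z : Circle) : turn (angleLift c z) = z := by
  rw [angleLift, turn_add]
  conv_lhs => arg 2; rw [turn, mul_div_cancel₀ _ (by positivity), Circle.exp_arg]
  rw [mul_left_comm, ← turn_add, add_neg_cancel]
  simp [turn]

theorem angleLift_turn_exists (c t : ℝ) : ∃ k : ℤ, angleLift c (turn t) = t + k :=
  turn_eq_turn.1 (turn_angleLift c (turn t))

/-- Rotation by `turn (-c)` takes the excluded point to -1, the only point of the circle on the
branch cut of the logarithm. -/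
theorem contMDiffAt_angleLift {c : ℝ} {z : Circle} (hz : z ≠ turn (c + 1 / 2)) :
    ContMDiffAt (𝓡 1) 𝓘(ℝ, ℝ) ∞ (angleLift c) z := by
  have hslit : ((z * turn (-c) : Circle) : ℂ) ∈ Complex.slitPlane := by
    rw [Complex.mem_slitPlane_iff_arg]
    refine ⟨fun h => hz ?_, Circle.coe_ne_zero _⟩
    have h2 : z * turn (-c) = turn (1 / 2) := by
      rw [← Circle.exp_arg (z * turn (-c)), h, turn]
      congr 1
      ring
    rw [turn_add, ← h2, mul_left_comm, ← turn_add, add_neg_cancel]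
    simp [turn]
  have h1 : ContMDiffAt (𝓡 1) 𝓘(ℝ, ℂ) ∞ (fun w : Circle => ((w * turn (-c) : Circle) : ℂ)) z :=
    (contMDiff_circle_coe.comp (contMDiff_mul_right (I := 𝓡 1) (a := turn (-c)))).contMDiffAt
  have h2 : ContDiffAt ℝ ∞ (fun w : ℂ => c + (Complex.log w).im / (2 * Real.pi))
      ((z * turn (-c) : Circle) : ℂ) :=
    contDiffAt_const.add ((Complex.imCLM.contDiff.contDiffAt.comp _
      ((Complex.contDiffAt_log hslit).restrict_scalars ℝ)).div_const _)
  refine (ContMDiffAt.comp (g := fun w : ℂ => c + (Complex.log w).im / (2 * Real.pi)) z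
    h2.contMDiffAt h1).congr_of_eventuallyEq (Filter.Eventually.of_forall fun w => ?_)
  simp [angleLift, Complex.log_im]

/-- Away from its jump, the normalized angle differs from a given angle by a locally constant
integer. -/
theorem eventually_angleLift_turn {c t₀ : ℝ} (h : turn t₀ ≠ turn (c + 1 / 2)) :
    ∃ k : ℤ, ∀ᶠ t in 𝓝 t₀, angleLift c (turn t) = t + k := by
  obtain ⟨k, hk⟩ := angleLift_turn_exists c t₀
  refine ⟨k, ?_⟩
  have hcont : ContinuousAt (fun t => angleLift c (turn t) - t) t₀ :=
    ((contMDiffAt_angleLift h).continuousAt.comp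
      contMDiff_turn.continuous.continuousAt).sub continuousAt_id
  have hval : angleLift c (turn t₀) - t₀ = k := by rw [hk]; ring
  -- The difference of the two angles is continuous at t₀ and integer-valued, and integers at
  -- distance less than 1 coincide.
  have hnear := hcont.eventually (Metric.ball_mem_nhds _ one_pos)
  filter_upwards [hnear] with t ht
  obtain ⟨l, hl⟩ := angleLift_turn_exists c t
  rw [hval, hl, add_sub_cancel_left, Real.dist_eq, ← Int.cast_sub,
    ← Int.cast_abs, ← Int.cast_one, Int.cast_lt, Int.abs_lt_one_iff] at ht
  rw [hl, show l = k by omega]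

/-- The `1`-form `v ↦ Im (z̄ v)` on the complex plane. -/
def planeAngularForm : DForm 𝓘(ℝ, ℂ) ℂ 1 :=
  oneForm fun z => Complex.imCLM.comp (ContinuousLinearMap.mul ℝ ℂ ((starRingEnd ℂ) z))

/-- Reduces smoothness of dθ to that of a form on the plane given by an explicit formula. -/
theorem pullback_planeAngularForm :
    DForm.pullback (𝓡 1) (fun z : Circle => (z : ℂ)) planeAngularForm = dTheta := rfl

theorem smoothAt_planeAngularForm (z : ℂ) : planeAngularForm.SmoothAt z := by
  let e := ContinuousAlternatingMap.ofSubsingletonLIE (𝕜 := ℝ) (E := ℂ) (F := ℝ) (0 : Fin 1)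
  have h : planeAngularForm.inChart z = fun w =>
      e (Complex.imCLM.comp (ContinuousLinearMap.mul ℝ ℂ ((starRingEnd ℂ) w))) := by
    funext w
    have h1 : mfderivWithin 𝓘(ℝ, ℂ) 𝓘(ℝ, ℂ) (extChartAt 𝓘(ℝ, ℂ) z).symm (range 𝓘(ℝ, ℂ)) w =
        ContinuousLinearMap.id ℝ ℂ := by
      simp only [mfld_simps, mfderivWithin_univ, mfderiv_eq_fderiv]
      exact fderiv_id
    unfold DForm.inChart
    rw [h1]
    rfl
  unfold DForm.SmoothAt
  rw [h]
  refine ContDiff.contDiffWithinAt (e.contDiff.comp (contDiff_const.clm_comp ?_))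
  exact (ContinuousLinearMap.mul ℝ ℂ).contDiff.comp Complex.conjCLE.contDiff

theorem smoothAt_dTheta (z : Circle) : dTheta.SmoothAt z := by
  rw [← pullback_planeAngularForm]
  exact (smoothAt_planeAngularForm _).pullback contMDiff_circle_coe.contMDiffAt

/-- The circle is one-dimensional, so any two tangent vectors are dependent and every 2-form
vanishes. -/
theorem d_dTheta : dTheta.d = 0 := by
  funext z
  ext v
  refine AlternatingMap.map_linearDependent (dTheta.d z).toAlternatingMap v fun hli => ?_
  have := LinearIndependent.fintype_card_le_finrank (R := ℝ)
    (M := EuclideanSpace ℝ (Fin 1)) (b := v) hli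
  simp at this

/-- The derivative of exp(2πit) is 2πi · exp(2πit), and multiplication by the conjugate cancels the
exponential. The nonzero value makes π^*dθ nonzero transversally to the fibres. -/
theorem dTheta_mfderiv_turn (t : ℝ) :
    dTheta (turn t) ![mfderiv 𝓘(ℝ, ℝ) (𝓡 1) turn t (1 : ℝ)] = 2 * Real.pi := by
  have h1 : mfderiv 𝓘(ℝ, ℝ) 𝓘(ℝ, ℂ) (fun s => (turn s : ℂ)) t =
      (mfderiv (𝓡 1) 𝓘(ℝ, ℂ) (fun z : Circle => (z : ℂ)) (turn t)).comp
        (mfderiv 𝓘(ℝ, ℝ) (𝓡 1) turn t) :=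
    mfderiv_comp t (contMDiff_circle_coe.mdifferentiable (by simp) _)
      (contMDiff_turn.mdifferentiable (by simp) _)
  have h2 : HasDerivAt (fun s : ℝ => (turn s : ℂ))
      (Complex.exp ((2 * Real.pi * t : ℝ) * Complex.I) * (2 * Real.pi * Complex.I)) t := by
    have h3 : HasDerivAt (fun s : ℝ => ((2 * Real.pi * s : ℝ) : ℂ) * Complex.I)
        (2 * Real.pi * Complex.I) t := by
      have := (((hasDerivAt_id t).const_mul (2 * Real.pi)).ofReal_comp).mul_const Complex.I
      simpa using this
    simpa [turn, Circle.coe_exp] using h3.cexp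
  rw [mfderiv_eq_fderiv] at h1
  have h4 : fderiv ℝ (fun s : ℝ => (turn s : ℂ)) t 1 =
      (turn t : ℂ) * (2 * Real.pi * Complex.I) := by
    rw [fderiv_apply_one_eq_deriv, h2.deriv]
    simp [turn, Circle.coe_exp]
  have h5 := (DFunLike.congr_fun h1 (1 : ℝ)).symm.trans h4
  refine (congrArg (fun u : ℂ => ((starRingEnd ℂ) (turn t : ℂ) * u).im) h5).trans ?_
  rw [← mul_assoc, ← Circle.coe_inv_eq_conj, ← Circle.coe_mul, inv_mul_cancel]
  simp

end CircleAngle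

/-! ### Smooth structure, boundary and compactness of the mapping torus. -/

section TorusGeometry

open MappingTorus

variable {E : Type*} [NormedAddCommGroup E] [NormedSpace ℝ E]
  {H : Type*} [TopologicalSpace H] {I : ModelWithCorners ℝ E H}
  {S : Type*} [TopologicalSpace S] [ChartedSpace H S]
  {E' : Type*} [NormedAddCommGroup E'] [NormedSpace ℝ E']
  {H' : Type*} [TopologicalSpace H'] {I' : ModelWithCorners ℝ E' H'}
  {N : Type*} [TopologicalSpace N] [ChartedSpace H' N]
  (φ : S ≃ₘ⟮I, I⟯ S)

theorem proj_fiberMap (t : ℝ) (x : S) : proj φ (fiberMap φ t x) = turn t := rfl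

theorem fiberMap_injective (t : ℝ) : Function.Injective (fiberMap φ t) := by
  intro x y hxy
  obtain ⟨k, hk⟩ := (mk_eq_iff φ).1 hxy
  have h2 : t + k = t := congrArg Prod.snd hk
  have hk0 : k = 0 := by
    have : (k : ℝ) = 0 := by linarith
    exact_mod_cast this
  subst hk0
  rw [deck_zero] at hk
  exact congrArg Prod.fst hk

theorem fiberMap_add_int (t : ℝ) (k : ℤ) (x : S) :
    fiberMap φ (t + k) ((φ.toEquiv ^ k : Equiv.Perm S) x) = fiberMap φ t x :=
  mk_deck φ k (x, t)

theorem zpow_apply_of_fixed {x : S} (hx : φ x = x) (k : ℤ) :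
    (φ.toEquiv ^ k : Equiv.Perm S) x = x :=
  Equiv.Perm.zpow_apply_eq_self_of_apply_eq_self hx k

/-- The lift of a point of the mapping torus used for its preferred chart. -/
def lift (p : MappingTorus φ) : S × ℝ := (mk_surjective φ).hasRightInverse.choose p

theorem mk_lift (p : MappingTorus φ) : mk φ (lift φ p) = p :=
  (mk_surjective φ).hasRightInverse.choose_spec p

theorem extChartAt_apply_eq (p q : MappingTorus φ) : extChartAt (I.prod 𝓘(ℝ, ℝ)) p q =
    extChartAt (I.prod 𝓘(ℝ, ℝ)) (lift φ p)
      ((isLocalHomeomorph_mk φ).localInverseAt (lift φ p) q) := rfl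

theorem extChartAt_symm_apply_eq (p : MappingTorus φ) (z : E × ℝ) :
    (extChartAt (I.prod 𝓘(ℝ, ℝ)) p).symm z =
      mk φ ((extChartAt (I.prod 𝓘(ℝ, ℝ)) (lift φ p)).symm z) := by
  have h : (extChartAt (I.prod 𝓘(ℝ, ℝ)) p).symm z =
      ((isLocalHomeomorph_mk φ).localInverseAt (lift φ p)).symm
        ((extChartAt (I.prod 𝓘(ℝ, ℝ)) (lift φ p)).symm z) := rfl
  rw [h, IsLocalHomeomorph.localInverseAt_symm]

theorem extChartAt_self_eq (p : MappingTorus φ) : extChartAt (I.prod 𝓘(ℝ, ℝ)) p p =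
    extChartAt (I.prod 𝓘(ℝ, ℝ)) (lift φ p) (lift φ p) := by
  rw [extChartAt_apply_eq]
  conv_lhs => arg 2; arg 2; rw [← mk_lift φ p]
  rw [IsLocalHomeomorph.localInverseAt_apply_self]

/-- The chart at p is a chart of S × ℝ at the preferred lift, and the factor ℝ has no boundary. -/
theorem exists_boundary_lift {p : MappingTorus φ}
    (hp : p ∈ (I.prod 𝓘(ℝ, ℝ)).boundary (MappingTorus φ)) :
    ∃ x ∈ I.boundary S, ∃ t, mk φ (x, t) = p := by
  refine ⟨(lift φ p).1, ?_, (lift φ p).2, mk_lift φ p⟩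
  by_contra hx
  rw [← I.compl_interior, mem_compl_iff, not_not] at hx
  rw [← ModelWithCorners.compl_interior] at hp
  refine hp ?_
  change extChartAt (I.prod 𝓘(ℝ, ℝ)) p p ∈ interior (range (I.prod 𝓘(ℝ, ℝ)))
  rw [extChartAt_self_eq, ModelWithCorners.range_prod, interior_prod_eq, extChartAt_prod]
  refine ⟨hx, ?_⟩
  simp

theorem compactSpace_mappingTorus [CompactSpace S] : CompactSpace (MappingTorus φ) := by
  have hc : IsCompact (mk φ '' (univ ×ˢ Icc (0 : ℝ) 1)) :=
    (isCompact_univ.prod isCompact_Icc).image (continuous_mk φ)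
  refine ⟨hc.of_isClosed_subset isClosed_univ fun p _ => ?_⟩
  obtain ⟨⟨x, t⟩, rfl⟩ := mk_surjective φ p
  -- Subtracting the integer part of t brings the representative into S × [0, 1].
  refine ⟨deck φ (-⌊t⌋) (x, t), ⟨mem_univ _, ?_⟩, mk_deck φ _ _⟩
  have h1 := Int.floor_le t
  have h2 := Int.lt_floor_add_one t
  simp only [deck, Int.cast_neg, mem_Icc]
  constructor <;> linarith

/-- Read in a chart, the quotient map is a local inverse of itself composed with itself, which is
locally a deck transformation. -/
theorem contMDiff_mk : ContMDiff (I.prod 𝓘(ℝ, ℝ)) (I.prod 𝓘(ℝ, ℝ)) ∞ (mk φ) := by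
  intro b
  rw [contMDiffAt_iff_target]
  refine ⟨(continuous_mk φ).continuousAt, ?_⟩
  have hsrc : mk φ b ∈ ((isLocalHomeomorph_mk φ).localInverseAt (lift φ (mk φ b))).source := by
    have := (isLocalHomeomorph_mk φ).apply_self_mem_localInverseAt_source (x := lift φ (mk φ b))
    rwa [mk_lift] at this
  have h1 := contMDiffAt_localInverse_transition φ (lift φ (mk φ b)) b hsrc
  have h2 : (isLocalHomeomorph_mk φ).localInverseAt (lift φ (mk φ b)) (mk φ b) =
      lift φ (mk φ b) := by
    conv_lhs => arg 2; rw [← mk_lift φ (mk φ b)]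
    rw [IsLocalHomeomorph.localInverseAt_apply_self]
  have h3 : ContMDiffAt (I.prod 𝓘(ℝ, ℝ)) 𝓘(ℝ, E × ℝ) ∞
      (extChartAt (I.prod 𝓘(ℝ, ℝ)) (lift φ (mk φ b))) (lift φ (mk φ b)) :=
    contMDiffAt_extChartAt
  exact h3.comp_of_eq h1 h2

theorem contMDiff_fiberMap (t : ℝ) : ContMDiff I (I.prod 𝓘(ℝ, ℝ)) ∞ (fiberMap φ t) :=
  (contMDiff_mk φ).comp (contMDiff_id.prodMk contMDiff_const)

variable [IsManifold I ∞ S]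

/-- Smoothness on the mapping torus can be checked on `S × ℝ`. -/
theorem contMDiffAt_of_comp_mk {F : MappingTorus φ → N} {b : S × ℝ}
    (h : ContMDiffAt (I.prod 𝓘(ℝ, ℝ)) I' ∞ (F ∘ mk φ) b) :
    ContMDiffAt (I.prod 𝓘(ℝ, ℝ)) I' ∞ F (mk φ b) := by
  obtain ⟨k, hk⟩ := (mk_eq_iff φ).1 (mk_lift φ (mk φ b))
  have h1 : ContMDiffAt (I.prod 𝓘(ℝ, ℝ)) I' ∞ (F ∘ mk φ) (lift φ (mk φ b)) := by
    -- Deck invariance moves the smoothness from the given representative to the lift that defines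
    -- the chart.
    have h2 : (F ∘ mk φ) ∘ deck φ k = F ∘ mk φ := by
      funext q
      simp [mk_deck]
    rw [← h2]
    exact (hk ▸ h).comp _ (contMDiff_deck φ k _)
  rw [contMDiffAt_iff_source]
  have h3 : F ∘ (extChartAt (I.prod 𝓘(ℝ, ℝ)) (mk φ b)).symm =
      (F ∘ mk φ) ∘ (extChartAt (I.prod 𝓘(ℝ, ℝ)) (lift φ (mk φ b))).symm := by
    funext z
    simp only [Function.comp_apply, extChartAt_symm_apply_eq]
  rw [h3, extChartAt_self_eq]
  refine ContMDiffAt.comp_contMDiffWithinAt _ ?_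
    (contMDiffWithinAt_extChartAt_symm_range _ (mem_extChartAt_target _))
  rwa [extChartAt_to_inv]

theorem contMDiff_proj : ContMDiff (I.prod 𝓘(ℝ, ℝ)) (𝓡 1) ∞ (proj φ) := by
  intro p
  obtain ⟨b, rfl⟩ := mk_surjective φ p
  exact contMDiffAt_of_comp_mk φ (contMDiff_turn.comp contMDiff_snd).contMDiffAt

end TorusGeometry

/-! ### Maps preserving β up to an exact form are closed under composition, inversion and powers. -/

section ExactMaps

variable {E : Type*} [NormedAddCommGroup E] [NormedSpace ℝ E]
  {H : Type*} [TopologicalSpace H] {I : ModelWithCorners ℝ E H}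
  {S : Type*} [TopologicalSpace S] [ChartedSpace H S]

theorem differential_add {g h : S → ℝ} (hg : ContMDiff I 𝓘(ℝ, ℝ) ∞ g)
    (hh : ContMDiff I 𝓘(ℝ, ℝ) ∞ h) :
    differential I (g + h) = differential I g + differential I h := by
  funext x
  have h1 := ((hg.mdifferentiable (by simp) x).hasMFDerivAt.add
    (hh.mdifferentiable (by simp) x).hasMFDerivAt).mfderiv
  ext v
  exact DFunLike.congr_fun h1 (v 0)

theorem contMDiff_const_smul (c : ℝ) {h : S → ℝ} (hh : ContMDiff I 𝓘(ℝ, ℝ) ∞ h) :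
    ContMDiff I 𝓘(ℝ, ℝ) ∞ (c • h) :=
  (contDiff_const_smul c).contMDiff.comp hh

theorem differential_smul (c : ℝ) {h : S → ℝ} (hh : ContMDiff I 𝓘(ℝ, ℝ) ∞ h) :
    differential I (c • h) = c • differential I h := by
  funext x
  have h1 := ((hh.mdifferentiable (by simp) x).hasMFDerivAt.const_smul c).mfderiv
  ext v
  exact DFunLike.congr_fun h1 (v 0)

/-- The pullback of `β` along `f` differs from `β` by an exact form. -/
def PreservesUpToExact (β : DForm I S 1) (f : S → S) : Prop :=
  ∃ h : S → ℝ, ContMDiff I 𝓘(ℝ, ℝ) ∞ h ∧ DForm.pullback I f β - β = differential I h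

/-- From g^*β = β + du and f^*β = β + dv follows (g ∘ f)^*β = f^*(β + du) = β + d(v + u ∘ f). -/
theorem PreservesUpToExact.comp {β : DForm I S 1} {f g : S → S} (hg : PreservesUpToExact β g)
    (hf : PreservesUpToExact β f) (hgs : ContMDiff I I ∞ g) (hfs : ContMDiff I I ∞ f) :
    PreservesUpToExact β (g ∘ f) := by
  obtain ⟨u, hu, hgu⟩ := hg
  obtain ⟨v, hv, hfv⟩ := hf
  refine ⟨u ∘ f + v, (hu.comp hfs).add hv, ?_⟩
  rw [differential_add (hu.comp hfs) hv]
  funext x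
  have h1 : DForm.pullback I (g ∘ f) β x = DForm.pullback I f (β + differential I u) x := by
    rw [DForm.pullback_comp_apply β (hgs.mdifferentiable (by simp) _)
      (hfs.mdifferentiable (by simp) _), ← hgu, add_sub_cancel]
  have h2 : DForm.pullback I f (β + differential I u) x =
      DForm.pullback I f β x + DForm.pullback I f (differential I u) x := rfl
  have h3 : DForm.pullback I f β x = β x + differential I v x := by
    rw [← hfv, Pi.sub_apply, add_sub_cancel]
  rw [Pi.sub_apply, h1, h2, h3, pullback_differential (hu.mdifferentiable (by simp) _)
    (hfs.mdifferentiable (by simp) _), Pi.add_apply]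
  abel

/-- Pulling f^*β = β + du back by f⁻¹ and solving for (f⁻¹)^*β gives the primitive -u ∘ f⁻¹. -/
theorem PreservesUpToExact.symm {β : DForm I S 1} {f : S ≃ₘ⟮I, I⟯ S}
    (hf : PreservesUpToExact β f) : PreservesUpToExact β f.symm := by
  obtain ⟨u, hu, hfu⟩ := hf
  have hus := hu.comp f.symm.contMDiff
  refine ⟨(-1 : ℝ) • (u ∘ f.symm), contMDiff_const_smul _ hus, ?_⟩
  rw [differential_smul _ hus]
  funext x
  have h1 : DForm.pullback I f.symm (DForm.pullback I f β) x = β x := by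
    rw [← DForm.pullback_comp_apply β (f.contMDiff.mdifferentiable (by simp) _)
      (f.symm.contMDiff.mdifferentiable (by simp) _)]
    have h2 : f ∘ f.symm = id := funext fun y => f.apply_symm_apply y
    rw [h2, DForm.pullback_id]
  have h3 : DForm.pullback I f.symm (differential I u) x =
      DForm.pullback I f.symm (DForm.pullback I f β) x - DForm.pullback I f.symm β x := by
    rw [← hfu]
    rfl
  rw [Pi.sub_apply, Pi.smul_apply, ← pullback_differential (hu.mdifferentiable (by simp) _)
    (f.symm.contMDiff.mdifferentiable (by simp) _), h3, h1]
  ext v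
  exact ((neg_one_mul _).trans (neg_sub _ _)).symm

theorem preservesUpToExact_id (β : DForm I S 1) : PreservesUpToExact β id := by
  refine ⟨fun _ => 0, contMDiff_const, ?_⟩
  rw [DForm.pullback_id, sub_self]
  funext x
  ext v
  exact (DFunLike.congr_fun (mfderiv_const (I := I) (I' := 𝓘(ℝ, ℝ)) (x := x) (c := (0 : ℝ)))
    (v 0)).symm

variable (φ : S ≃ₘ⟮I, I⟯ S)

theorem PreservesUpToExact.zpow {β : DForm I S 1} {φ : S ≃ₘ⟮I, I⟯ S}
    (hφ : PreservesUpToExact β φ) (k : ℤ) :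
    PreservesUpToExact β (φ.toEquiv ^ k : Equiv.Perm S) := by
  induction k using Int.induction_on with
  | zero => exact preservesUpToExact_id β
  | succ k ih =>
    rw [zpow_add_one]
    exact ih.comp hφ (MappingTorus.contMDiff_zpow φ k) φ.contMDiff
  | pred k ih =>
    rw [zpow_sub_one]
    exact ih.comp hφ.symm (MappingTorus.contMDiff_zpow φ _) φ.symm.contMDiff

/-- The integer powers of a diffeomorphism. -/
def zpowDiffeo (k : ℤ) : S ≃ₘ⟮I, I⟯ S where
  toEquiv := φ.toEquiv ^ k
  contMDiff_toFun := MappingTorus.contMDiff_zpow φ k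
  contMDiff_invFun := by
    have h := MappingTorus.contMDiff_zpow φ (-k)
    rw [zpow_neg] at h
    exact h

theorem IsExactRelBoundary.zpowDiffeo {β : DForm I S 1} {φ : S ≃ₘ⟮I, I⟯ S}
    (hφ : IsExactRelBoundary β φ) (k : ℤ) : IsExactRelBoundary β (zpowDiffeo φ k) := by
  refine ⟨PreservesUpToExact.zpow hφ.1 k, ?_⟩
  filter_upwards [hφ.2] with x hx
  exact zpow_apply_of_fixed φ hx k

end ExactMaps

/-! ### Standard trivializations over the circle minus a point. -/

section Trivializations

open MappingTorus

variable {E : Type*} [NormedAddCommGroup E] [NormedSpace ℝ E]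
  {H : Type*} [TopologicalSpace H] {I : ModelWithCorners ℝ E H}
  {S : Type*} [TopologicalSpace S] [ChartedSpace H S]
  (φ : S ≃ₘ⟮I, I⟯ S)

theorem mem_range_fiberMap_angleLift (c : ℝ) (p : MappingTorus φ) :
    ∃ x, fiberMap φ (angleLift c (proj φ p)) x = p := by
  have h : p ∈ range (fiberMap φ (angleLift c (proj φ p))) := by
    rw [range_fiberMap]
    exact (turn_angleLift c (proj φ p)).symm
  exact h

/-- The coordinate in `S` of a point of the mapping torus, relative to the section `angleLift c` of
the covering of the circle. -/
def fiberCoord (c : ℝ) (p : MappingTorus φ) : S := (mem_range_fiberMap_angleLift φ c p).choose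

theorem fiberMap_fiberCoord (c : ℝ) (p : MappingTorus φ) :
    fiberMap φ (angleLift c (proj φ p)) (fiberCoord φ c p) = p :=
  (mem_range_fiberMap_angleLift φ c p).choose_spec

/-- The parametrizations of one fibre by the parameters t and t + k differ by φᵏ. Thus the
transition maps are powers of the monodromy. -/
theorem fiberCoord_fiberMap {c t : ℝ} {k : ℤ} (hk : angleLift c (turn t) = t + k) (x : S) :
    fiberCoord φ c (fiberMap φ t x) = (φ.toEquiv ^ k : Equiv.Perm S) x := by
  have h := fiberMap_fiberCoord φ c (fiberMap φ t x)
  rw [proj_fiberMap, hk, ← fiberMap_add_int φ t k x] at h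
  rw [← fiberMap_add_int φ t k x]
  exact fiberMap_injective φ _ h

theorem contMDiffAt_fiberMap_angleLift {c : ℝ} {q : Circle × S}
    (hq : q.1 ≠ turn (c + 1 / 2)) :
    ContMDiffAt ((𝓡 1).prod I) (I.prod 𝓘(ℝ, ℝ)) ∞
      (fun q : Circle × S => fiberMap φ (angleLift c q.1) q.2) q :=
  (contMDiff_mk φ).contMDiffAt.comp q (contMDiffAt_snd.prodMk
    ((contMDiffAt_angleLift hq).comp q contMDiffAt_fst))

variable [IsManifold I ∞ S]

/-- Away from the jump of the angle the exponent k is locally constant, so upstairs the coordinate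
is (x, t) ↦ φᵏ x with fixed k. -/
theorem contMDiffAt_fiberCoord {c : ℝ} {p : MappingTorus φ}
    (hp : proj φ p ≠ turn (c + 1 / 2)) :
    ContMDiffAt (I.prod 𝓘(ℝ, ℝ)) I ∞ (fiberCoord φ c) p := by
  obtain ⟨b, rfl⟩ := mk_surjective φ p
  refine contMDiffAt_of_comp_mk φ ?_
  obtain ⟨k, hk⟩ := eventually_angleLift_turn hp
  refine ((contMDiff_zpow φ k).comp contMDiff_fst).contMDiffAt.congr_of_eventuallyEq ?_
  filter_upwards [continuous_snd.continuousAt.eventually hk] with q hq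
  exact fiberCoord_fiberMap φ hq q.1

/-- The trivialization of the mapping torus over the complement of a point of the circle. -/
def standardHomeo (c : ℝ) : OpenPartialHomeomorph (MappingTorus φ) (Circle × S) where
  toFun p := (proj φ p, fiberCoord φ c p)
  invFun q := fiberMap φ (angleLift c q.1) q.2
  source := proj φ ⁻¹' {turn (c + 1 / 2)}ᶜ
  target := {turn (c + 1 / 2)}ᶜ ×ˢ univ
  map_source' p hp := ⟨hp, mem_univ _⟩
  map_target' q hq := by
    rw [mem_preimage, proj_fiberMap, turn_angleLift]
    exact hq.1
  left_inv' p _ := fiberMap_fiberCoord φ c p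
  right_inv' q _ := by
    have h1 : proj φ (fiberMap φ (angleLift c q.1) q.2) = q.1 := by
      rw [proj_fiberMap, turn_angleLift]
    have h2 := fiberMap_fiberCoord φ c (fiberMap φ (angleLift c q.1) q.2)
    rw [h1] at h2
    exact Prod.ext h1 (fiberMap_injective φ _ h2)
  open_source := isOpen_compl_singleton.preimage (contMDiff_proj φ).continuous
  open_target := isOpen_compl_singleton.prod isOpen_univ
  continuousOn_toFun p hp := ((contMDiff_proj φ).continuous.continuousAt.prodMk
    (contMDiffAt_fiberCoord φ hp).continuousAt).continuousWithinAt
  continuousOn_invFun q hq :=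
    (contMDiffAt_fiberMap_angleLift φ hq.1).continuousAt.continuousWithinAt

variable {φ} {β : DForm I S 1}

/-- The standard trivialization belongs to the bundle structure given by exact maps. -/
def standardTrivialization (hφ : IsExactRelBoundary β φ) (c : ℝ) : ExactTrivialization β φ where
  baseSet := {turn (c + 1 / 2)}ᶜ
  toHomeo := standardHomeo φ c
  source_eq := rfl
  target_eq := rfl
  smooth p hp :=
    ((contMDiff_proj φ p).prodMk (contMDiffAt_fiberCoord φ hp)).contMDiffWithinAt
  smooth_symm q hq := (contMDiffAt_fiberMap_angleLift φ hq.1).contMDiffWithinAt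
  fst_eq p _ := rfl
  exact_fiber t _ := by
    obtain ⟨k, hk⟩ := angleLift_turn_exists c t
    exact ⟨zpowDiffeo φ k, hφ.zpowDiffeo k, fun x => fiberCoord_fiberMap φ hk x⟩
  eq_near_boundary t₀ _ := by
    -- Every fibre map is a power of φ, so the fixed point set of φ serves for all t at once.
    refine ⟨{x | φ x = x}, hφ.2, Filter.Eventually.of_forall fun t x hx => ?_⟩
    obtain ⟨k, hk⟩ := angleLift_turn_exists c t
    exact (fiberCoord_fiberMap φ hk x).trans (zpow_apply_of_fixed φ hx k)

theorem exists_trivializations (hφ : IsExactRelBoundary β φ) :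
    ∃ (Φ : Fin 2 → ExactTrivialization β φ)
      (f : SmoothPartitionOfUnity (Fin 2) (𝓡 1) Circle univ),
      f.IsSubordinate fun i => (Φ i).baseSet := by
  -- The omitted points are `turn (1 / 2)` = -1 and `turn 1` = 1; being distinct, their complements
  -- cover the circle.
  let c : Fin 2 → ℝ := ![0, 1 / 2]
  refine ⟨fun i => standardTrivialization hφ (c i), ?_⟩
  refine SmoothPartitionOfUnity.exists_isSubordinate (𝓡 1) isClosed_univ _
    (fun i => isOpen_compl_singleton) fun z _ => ?_
  rw [mem_iUnion]
  by_contra! h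
  have h0 : z = turn (0 + 1 / 2) := by simpa [standardTrivialization, c] using h 0
  have h1 : z = turn (1 / 2 + 1 / 2) := by simpa [standardTrivialization, c] using h 1
  obtain ⟨m, hm⟩ := turn_eq_turn.1 (h0.symm.trans h1)
  have h2 : (-1 : ℝ) = ((2 * m : ℤ) : ℝ) := by push_cast; linarith
  have h3 : (-1 : ℤ) = 2 * m := by exact_mod_cast h2
  omega

end Trivializations

/-! ### Domination of λ ∧ (dλ)ⁿ by K θ ∧ (dλ)ⁿ on a compact manifold. -/

section UniformContact

variable {E : Type*} [NormedAddCommGroup E] [NormedSpace ℝ E]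
  {H : Type*} [TopologicalSpace H]
  {I : ModelWithCorners ℝ E H}
  {M : Type*} [TopologicalSpace M] [ChartedSpace H M] {k : ℕ}

theorem continuousWithinAt_wedge_wedgePow {X : Type*} [TopologicalSpace X]
    {a : X → E [⋀^Fin 1]→L[ℝ] ℝ} {ζ : X → E [⋀^Fin 2]→L[ℝ] ℝ} {s : Set X} {x : X}
    (ha : ContinuousWithinAt a s x) (hζ : ContinuousWithinAt ζ s x) (n : ℕ)
    (v : Fin (1 + 2 * n) → E) :
    ContinuousWithinAt
      (fun y => wedge (a y).toAlternatingMap (wedgePow (ζ y).toAlternatingMap n) v) s x := by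
  simp only [wedge_wedgePow_apply]
  have hev : ∀ {l : ℕ} {b : X → E [⋀^Fin l]→L[ℝ] ℝ}, ContinuousWithinAt b s x →
      ∀ u : Fin l → E, ContinuousWithinAt (fun y => (b y).toAlternatingMap u) s x := by
    intro l b hb u
    exact (continuous_eval_const (F := E [⋀^Fin l]→L[ℝ] ℝ) u).continuousAt.comp_continuousWithinAt
      hb
  refine continuousWithinAt_const.mul (tendsto_finsetSum _ fun σ _ => ?_)
  exact continuousWithinAt_const.mul ((hev ha _).mul
    (tendsto_finsetProd _ fun i _ => hev hζ _))

theorem continuousWithinAt_extDerivWithin {η : E → E [⋀^Fin k]→L[ℝ] ℝ} {s : Set E} {x : E}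
    (h : ContDiffWithinAt ℝ ∞ η s x) (hs : UniqueDiffOn ℝ s) (hx : x ∈ s) :
    ContinuousWithinAt (extDerivWithin η s) s x :=
  (ContinuousAlternatingMap.alternatizeUncurryFinCLM ℝ E ℝ).continuous.continuousAt.comp_continuousWithinAt
    (h.fderivWithin_right (m := ∞) hs (by simp) hx).continuousWithinAt

variable [IsManifold I ∞ M]

theorem DForm.eq_inChart_comp (η : DForm I M k) {x₀ x : M} (hx : x ∈ (extChartAt I x₀).source) :
    η x = (η.inChart x₀ (extChartAt I x₀ x)).compContinuousLinearMap
      (mfderiv I 𝓘(ℝ, E) (extChartAt I x₀) x) := by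
  have : IsManifold I 1 M := .of_le (n := ∞) (by simp)
  have h := mfderivWithin_extChartAt_symm_comp_mfderiv_extChartAt' (I := I) hx
  refine (compContinuousLinearMap_congr_point (E'' := E) η ((extChartAt I x₀).left_inv hx)
    (ContinuousLinearMap.comp (mfderivWithin 𝓘(ℝ, E) I (extChartAt I x₀).symm (range I)
      (extChartAt I x₀ x)) (mfderiv I 𝓘(ℝ, E) (extChartAt I x₀) x))
    (ContinuousLinearMap.id ℝ E) ?_).symm
  ext v
  exact DFunLike.congr_fun h v

/-- In one fixed chart the forms at all nearby points live on the same vector space, so they can be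
compared on a fixed tuple of vectors. -/
theorem wedge_wedgePow_eq_inChart {η ζ : DForm I M 1} (hζ : ∀ x, ζ.SmoothAt x) (n : ℕ) {x₀ x : M}
    (hx : x ∈ (extChartAt I x₀).source) :
    wedge (η x).toAlternatingMap (wedgePow (ζ.d x).toAlternatingMap n) =
      (wedge (η.inChart x₀ (extChartAt I x₀ x)).toAlternatingMap
        (wedgePow (extDerivWithin (ζ.inChart x₀) (range I)
          (extChartAt I x₀ x)).toAlternatingMap n)).compLinearMap
        (show E →ₗ[ℝ] E from (mfderiv I 𝓘(ℝ, E) (extChartAt I x₀) x).toLinearMap) := by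
  rw [← wedge_wedgePow_compLinearMap, DForm.d_eq_of_mem_source (hζ x) hx,
    η.eq_inChart_comp hx]
  rfl

/-- On a fixed tuple v the expression is A + K·B in coordinates, with A and B continuous and B
nonzero at the base point; for large K the second term wins nearby. -/
theorem eventually_wedge_wedgePow_ne_zero {η θ : DForm I M 1} (hη : ∀ x, η.SmoothAt x)
    (hθ : ∀ x, θ.SmoothAt x) {n : ℕ} (x₀ : M)
    (h₀ : wedge (θ x₀).toAlternatingMap (wedgePow (η.d x₀).toAlternatingMap n) ≠ 0) :
    ∃ K₀ : ℝ, 0 < K₀ ∧ ∀ᶠ x in 𝓝 x₀, ∀ K, K₀ ≤ K →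
      wedge ((η + K • θ) x).toAlternatingMap (wedgePow (η.d x).toAlternatingMap n) ≠ 0 := by
  have : IsManifold I 1 M := .of_le (n := ∞) (by simp)
  let y₀ := extChartAt I x₀ x₀
  let ω' := extDerivWithin (η.inChart x₀) (range I)
  have hy₀ : y₀ ∈ range I := mem_range_self _
  have hω' : ContinuousWithinAt ω' (range I) y₀ :=
    continuousWithinAt_extDerivWithin (hη x₀) I.uniqueDiffOn hy₀
  rw [wedge_wedgePow_eq_inChart hη n (mem_extChartAt_source x₀)] at h₀
  obtain ⟨v, hv⟩ : ∃ v, wedge (θ.inChart x₀ y₀).toAlternatingMap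
      (wedgePow (ω' y₀).toAlternatingMap n) v ≠ 0 := by
    by_contra! h
    refine h₀ ?_
    rw [show wedge (θ.inChart x₀ y₀).toAlternatingMap
      (wedgePow (ω' y₀).toAlternatingMap n) = 0 from AlternatingMap.ext h]
    rfl
  let A : E → ℝ := fun y => wedge (η.inChart x₀ y).toAlternatingMap
    (wedgePow (ω' y).toAlternatingMap n) v
  let B : E → ℝ := fun y => wedge (θ.inChart x₀ y).toAlternatingMap
    (wedgePow (ω' y).toAlternatingMap n) v
  have hA : ContinuousWithinAt A (range I) y₀ :=
    continuousWithinAt_wedge_wedgePow (hη x₀).continuousWithinAt hω' n v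
  have hB : ContinuousWithinAt B (range I) y₀ :=
    continuousWithinAt_wedge_wedgePow (hθ x₀).continuousWithinAt hω' n v
  have hB0 : 0 < |B y₀| := abs_pos.2 hv
  -- The quotient of the local bounds |A| < |A y₀| + 1 and |B| > |B y₀| / 2.
  refine ⟨2 * (|A y₀| + 1) / |B y₀|, by positivity, ?_⟩
  have hev : ∀ᶠ y in 𝓝[range I] y₀, |A y| < |A y₀| + 1 ∧ |B y₀| / 2 < |B y| :=
    (hA.abs.eventually (gt_mem_nhds (by linarith))).and
      (hB.abs.eventually (lt_mem_nhds (by linarith)))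
  have hmap : Filter.Tendsto (extChartAt I x₀) (𝓝 x₀) (𝓝[range I] y₀) :=
    tendsto_nhdsWithin_iff.2 ⟨continuousAt_extChartAt x₀,
      Filter.Eventually.of_forall fun x => mem_range_self _⟩
  filter_upwards [hmap.eventually hev, (isOpen_extChartAt_source (I := I) x₀).mem_nhds
    (mem_extChartAt_source x₀)] with x hx hxs K hK h0
  rw [wedge_wedgePow_eq_inChart hη n hxs] at h0
  -- The chart has invertible derivative, so the fixed tuple v comes from tangent vectors at x.
  obtain ⟨u, hu⟩ : ∃ u : Fin (1 + 2 * n) → E,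
      (fun i => mfderiv I 𝓘(ℝ, E) (extChartAt I x₀) x (u i)) = v := by
    obtain ⟨L, hL⟩ := isInvertible_mfderiv_extChartAt (I := I) hxs
    refine ⟨fun i => L.symm (v i), funext fun i => ?_⟩
    rw [← hL]
    exact L.apply_symm_apply (v i)
  have h1 : wedge ((η + K • θ).inChart x₀ (extChartAt I x₀ x)).toAlternatingMap
      (wedgePow (ω' (extChartAt I x₀ x)).toAlternatingMap n) v = 0 := by
    rw [← hu]
    exact DFunLike.congr_fun h0 u
  have h2 : A (extChartAt I x₀ x) + K * B (extChartAt I x₀ x) = 0 := by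
    refine Eq.trans ?_ h1
    have h3 : ((η + K • θ).inChart x₀ (extChartAt I x₀ x)).toAlternatingMap =
        (η.inChart x₀ (extChartAt I x₀ x)).toAlternatingMap +
          K • (θ.inChart x₀ (extChartAt I x₀ x)).toAlternatingMap := rfl
    have h4 := wedge_smul K 1 (θ.inChart x₀ (extChartAt I x₀ x)).toAlternatingMap
      (wedgePow (ω' (extChartAt I x₀ x)).toAlternatingMap n)
    rw [one_smul, mul_one] at h4
    rw [h3, wedge_add_left, h4]
    rfl
  rw [div_le_iff₀ hB0] at hK
  have h5 : |K * B (extChartAt I x₀ x)| = |A (extChartAt I x₀ x)| := by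
    rw [show K * B (extChartAt I x₀ x) = -A (extChartAt I x₀ x) by linarith, abs_neg]
  have hKpos : 0 < K := by
    by_contra! hneg
    have := mul_nonpos_of_nonpos_of_nonneg hneg hB0.le
    linarith [abs_nonneg (A y₀)]
  rw [abs_mul, abs_of_pos hKpos] at h5
  -- Vanishing would give |A y₀| + 1 ≤ K|B y₀|/2 < K|B| = |A| < |A y₀| + 1.
  have h6 := mul_lt_mul_of_pos_left hx.2 hKpos
  linarith [hx.1]

/-- On a compact manifold, `(η + K θ) ∧ (dη)ⁿ` vanishes nowhere for large `K` as soon as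
`θ ∧ (dη)ⁿ` vanishes nowhere. -/
theorem exists_forall_wedge_wedgePow_ne_zero [CompactSpace M] {η θ : DForm I M 1}
    (hη : ∀ x, η.SmoothAt x) (hθ : ∀ x, θ.SmoothAt x) {n : ℕ}
    (h₀ : ∀ x, wedge (θ x).toAlternatingMap (wedgePow (η.d x).toAlternatingMap n) ≠ 0) :
    ∃ K₀ : ℝ, 0 < K₀ ∧ ∀ K, K₀ ≤ K → ∀ x,
      wedge ((η + K • θ) x).toAlternatingMap (wedgePow (η.d x).toAlternatingMap n) ≠ 0 := by
  suffices h : ∃ K₀ : ℝ, 0 < K₀ ∧ ∀ x ∈ (univ : Set M), ∀ K, K₀ ≤ K →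
      wedge ((η + K • θ) x).toAlternatingMap (wedgePow (η.d x).toAlternatingMap n) ≠ 0 by
    obtain ⟨K₀, hK₀, h⟩ := h
    exact ⟨K₀, hK₀, fun K hK x => h x (mem_univ x) K hK⟩
  refine isCompact_univ.induction_on ⟨1, one_pos, fun x hx => hx.elim⟩ ?_ ?_ ?_
  · rintro s t hst ⟨K₀, hK₀, h⟩
    exact ⟨K₀, hK₀, fun x hx => h x (hst hx)⟩
  · rintro s t ⟨K₁, hK₁, h₁⟩ ⟨K₂, hK₂, h₂⟩
    refine ⟨max K₁ K₂, lt_max_of_lt_left hK₁, ?_⟩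
    rintro x (hx | hx) K hK
    · exact h₁ x hx K ((le_max_left _ _).trans hK)
    · exact h₂ x hx K ((le_max_right _ _).trans hK)
  · intro x _
    obtain ⟨K₀, hK₀, h⟩ := eventually_wedge_wedgePow_ne_zero hη hθ x (h₀ x)
    exact ⟨_, mem_nhdsWithin_of_mem_nhds h, K₀, hK₀, fun y hy => hy⟩

end UniformContact

/-! ### The patched form on the fibres, and the contact condition. -/

section PatchedForm

open MappingTorus

variable {E : Type*} [NormedAddCommGroup E] [NormedSpace ℝ E]
  {H : Type*} [TopologicalSpace H] {I : ModelWithCorners ℝ E H}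
  {S : Type*} [TopologicalSpace S] [ChartedSpace H S]
  {β : DForm I S 1} {φ : S ≃ₘ⟮I, I⟯ S} {ι : Type*}
  (Φ : ι → ExactTrivialization β φ) (f : SmoothPartitionOfUnity ι (𝓡 1) Circle univ)

/-- A single term of the patched form. -/
def patchTerm (i : ι) : DForm (I.prod 𝓘(ℝ, ℝ)) (MappingTorus φ) 1 :=
  fun p => f i (proj φ p) •
    DForm.pullback (I.prod 𝓘(ℝ, ℝ)) (Φ i).toHomeo
      (DForm.pullback ((𝓡 1).prod I) (Prod.snd : Circle × S → S) β) p

theorem const_fin_one_eq {X : Type*} (u : X) : (fun _ : Fin 1 => u) = ![u] := by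
  funext i
  fin_cases i
  rfl

variable {Φ f}

theorem ExactTrivialization.contMDiffAt (Ψ : ExactTrivialization β φ) {p : MappingTorus φ}
    (hp : proj φ p ∈ Ψ.baseSet) :
    ContMDiffAt (I.prod 𝓘(ℝ, ℝ)) ((𝓡 1).prod I) ∞ Ψ.toHomeo p := by
  have hp' : p ∈ Ψ.toHomeo.source := by rwa [Ψ.source_eq]
  exact Ψ.smooth.contMDiffAt (Ψ.toHomeo.open_source.mem_nhds hp')

theorem mem_baseSet_of_ne_zero (hf : f.IsSubordinate fun i => (Φ i).baseSet) {i : ι} {z : Circle}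
    (h : f i z ≠ 0) : z ∈ (Φ i).baseSet :=
  hf i (subset_tsupport _ h)

/-- Near a point of the circle, only finitely many functions of the partition are nonzero. -/
theorem exists_finset_eventually_eq_sum (f : SmoothPartitionOfUnity ι (𝓡 1) Circle univ)
    (z : Circle) : ∃ s : Finset ι, ∀ᶠ w in 𝓝 z, ∀ i, f i w ≠ 0 → i ∈ s := by
  obtain ⟨N, hN, hfin⟩ := f.locallyFinite z
  refine ⟨hfin.toFinset, ?_⟩
  filter_upwards [hN] with w hw i hi
  exact hfin.mem_toFinset.2 ⟨w, hi, hw⟩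

theorem patchedForm_eq_sum {p : MappingTorus φ} {s : Finset ι}
    (hs : ∀ i, f i (proj φ p) ≠ 0 → i ∈ s) :
    patchedForm Φ f p = ∑ i ∈ s, patchTerm Φ f i p := by
  refine finsum_eq_sum_of_support_subset _ fun i hi => hs i fun h0 => hi ?_
  change f i (proj φ p) • _ = _
  rw [h0, zero_smul]

theorem sum_eq_one {z : Circle} {s : Finset ι} (hs : ∀ i, f i z ≠ 0 → i ∈ s) :
    ∑ i ∈ s, f i z = 1 := by
  rw [← f.sum_eq_one (mem_univ z)]
  exact (finsum_eq_sum_of_support_subset _ fun i hi => hs i hi).symm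

/-- The restriction of the patched form to a fibre differs from `β` by an exact form. -/
theorem exists_pullback_fiberMap_patchedForm (hf : f.IsSubordinate fun i => (Φ i).baseSet)
    (t : ℝ) : ∃ h : S → ℝ, ContMDiff I 𝓘(ℝ, ℝ) ∞ h ∧
      DForm.pullback I (fiberMap φ t) (patchedForm Φ f) = β + differential I h := by
  obtain ⟨s, hs⟩ := exists_finset_eventually_eq_sum f (turn t)
  have hs := hs.self_of_nhds
  have hterm : ∀ i, ∃ h : S → ℝ, ContMDiff I 𝓘(ℝ, ℝ) ∞ h ∧
      DForm.pullback I (fiberMap φ t) (patchTerm Φ f i) =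
        f i (turn t) • β + differential I h := by
    intro i
    by_cases h0 : f i (turn t) = 0
    · refine ⟨fun _ => 0, contMDiff_const, ?_⟩
      funext x
      have h1 : patchTerm Φ f i (fiberMap φ t x) = 0 := by
        change f i (turn t) • _ = _
        rw [h0, zero_smul]
      have h2 : differential I (fun _ : S => (0 : ℝ)) x = 0 := by
        ext v
        exact DFunLike.congr_fun (mfderiv_const (I := I) (I' := 𝓘(ℝ, ℝ)) (x := x) (c := (0 : ℝ)))
          (v 0)
      rw [Pi.add_apply, h2, h0, zero_smul, Pi.zero_apply, add_zero, DForm.pullback, h1]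
      rfl
    · have hb := mem_baseSet_of_ne_zero hf h0
      obtain ⟨ψ, ⟨⟨h, hh, hψ⟩, -⟩, hψeq⟩ := (Φ i).exact_fiber t hb
      refine ⟨f i (turn t) • h, contMDiff_const_smul _ hh, ?_⟩
      rw [differential_smul _ hh, ← hψ]
      funext x
      have hd := ((Φ i).contMDiffAt (p := fiberMap φ t x) hb).mdifferentiableAt (by simp)
      have hm := (contMDiff_fiberMap φ t).mdifferentiable (by simp) x
      have h1 : DForm.pullback I (fiberMap φ t) (patchTerm Φ f i) x = f i (turn t) •
          DForm.pullback I (fiberMap φ t) (DForm.pullback (I.prod 𝓘(ℝ, ℝ)) (Φ i).toHomeo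
            (DForm.pullback ((𝓡 1).prod I) (Prod.snd : Circle × S → S) β)) x := rfl
      -- On the fibre the trivialization is ψ with ψ^*β = β + dh, and its weight is a constant;
      -- hence the term is fᵢβ + d(fᵢh).
      have h2 : (Prod.snd : Circle × S → S) ∘ ((Φ i).toHomeo ∘ fiberMap φ t) = ψ :=
        funext hψeq
      rw [h1, ← DForm.pullback_comp_apply _ hd hm,
        ← DForm.pullback_comp_apply _ mdifferentiableAt_snd (hd.comp x hm), h2, Pi.add_apply,
        Pi.smul_apply, Pi.smul_apply, ← smul_add, Pi.sub_apply, add_sub_cancel]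
  have hsum : ∀ s : Finset ι, ∃ h : S → ℝ, ContMDiff I 𝓘(ℝ, ℝ) ∞ h ∧
      ∑ i ∈ s, DForm.pullback I (fiberMap φ t) (patchTerm Φ f i) =
        (∑ i ∈ s, f i (turn t)) • β + differential I h := by
    classical
    intro s
    induction s using Finset.induction_on with
    | empty =>
      -- Writing the zero function as a multiple by 0 makes its differential vanish by
      -- `differential_smul`.
      refine ⟨(0 : ℝ) • fun _ => 0, contMDiff_const_smul _ contMDiff_const, ?_⟩
      rw [differential_smul _ contMDiff_const]
      simp
    | insert a s ha ih =>
      obtain ⟨u, hu, hsu⟩ := ih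
      obtain ⟨v, hv, hav⟩ := hterm a
      refine ⟨v + u, hv.add hu, ?_⟩
      rw [Finset.sum_insert ha, Finset.sum_insert ha, hsu, hav, differential_add hv hu, add_smul]
      abel
  obtain ⟨h, hh, hsh⟩ := hsum s
  refine ⟨h, hh, ?_⟩
  rw [sum_eq_one hs, one_smul] at hsh
  rw [← hsh]
  funext x
  rw [Finset.sum_apply]
  have h1 : patchedForm Φ f (fiberMap φ t x) = ∑ i ∈ s, patchTerm Φ f i (fiberMap φ t x) :=
    patchedForm_eq_sum hs
  ext v
  rw [DForm.pullback, h1]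
  simp [DForm.pullback, ContinuousAlternatingMap.sum_apply]

theorem pullback_fiberMap_pullback_proj (t : ℝ) (η : DForm (𝓡 1) Circle 1)
    [IsManifold I ∞ S] :
    DForm.pullback I (fiberMap φ t) (DForm.pullback (I.prod 𝓘(ℝ, ℝ)) (proj φ) η) = 0 := by
  funext x
  rw [← DForm.pullback_comp_apply η ((contMDiff_proj φ).mdifferentiable (by simp) _)
    ((contMDiff_fiberMap φ t).mdifferentiable (by simp) _)]
  have h : proj φ ∘ fiberMap φ t = fun _ => turn t := rfl
  rw [h]
  ext v
  refine (η (turn t)).map_coord_zero 0 ?_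
  exact DFunLike.congr_fun (mfderiv_const (I := I) (I' := 𝓡 1) (x := x) (c := turn t)) (v 0)

variable [IsManifold I ∞ S]

/-- On the support of fᵢ the trivialization is smooth. Off it the term vanishes in a neighbourhood,
whatever the trivialization does there. -/
theorem smoothAt_patchTerm (hβ : ∀ x, β.SmoothAt x)
    (hf : f.IsSubordinate fun i => (Φ i).baseSet) (i : ι) (p : MappingTorus φ) :
    (patchTerm Φ f i).SmoothAt p := by
  by_cases hp : proj φ p ∈ tsupport (f i)
  · have hΦ := (Φ i).contMDiffAt (hf i hp)
    refine DForm.SmoothAt.smul (g := fun p => f i (proj φ p)) ?_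
      (((f i).contMDiff.comp (contMDiff_proj φ)).contMDiffAt)
    exact ((hβ _).pullback contMDiffAt_snd).pullback hΦ
  · refine (DForm.smoothAt_zero p).congr ?_
    filter_upwards [(contMDiff_proj φ).continuous.continuousAt.preimage_mem_nhds
      ((isClosed_tsupport _).isOpen_compl.mem_nhds hp)] with q hq
    change f i (proj φ q) • _ = _
    rw [image_eq_zero_of_notMem_tsupport hq, zero_smul]
    rfl

theorem smoothAt_patchedForm (hβ : ∀ x, β.SmoothAt x)
    (hf : f.IsSubordinate fun i => (Φ i).baseSet) (p : MappingTorus φ) :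
    (patchedForm Φ f).SmoothAt p := by
  obtain ⟨s, hs⟩ := exists_finset_eventually_eq_sum f (proj φ p)
  refine (DForm.SmoothAt.sum s fun i _ => smoothAt_patchTerm hβ hf i p).congr ?_
  filter_upwards [(contMDiff_proj φ).continuous.continuousAt.eventually hs] with q hq
  rw [Finset.sum_apply]
  exact patchedForm_eq_sum hq

theorem smoothAt_pullback_proj_dTheta (p : MappingTorus φ) :
    (DForm.pullback (I.prod 𝓘(ℝ, ℝ)) (proj φ) dTheta).SmoothAt p :=
  (smoothAt_dTheta _).pullback (contMDiff_proj φ p)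

theorem smoothAt_bundleForm (hβ : ∀ x, β.SmoothAt x)
    (hf : f.IsSubordinate fun i => (Φ i).baseSet) (K : ℝ) (p : MappingTorus φ) :
    (bundleForm Φ f K).SmoothAt p :=
  (smoothAt_patchedForm hβ hf p).add ((smoothAt_pullback_proj_dTheta p).const_smul K)

/-- Closedness of dθ removes K from dσ; this is what makes the contact condition affine in K. -/
theorem d_bundleForm (hβ : ∀ x, β.SmoothAt x)
    (hf : f.IsSubordinate fun i => (Φ i).baseSet) (K : ℝ) :
    (bundleForm Φ f K).d = (patchedForm Φ f).d := by
  funext p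
  have h : DForm.pullback (I.prod 𝓘(ℝ, ℝ)) (proj φ) dTheta.d p = 0 := by
    rw [d_dTheta]
    rfl
  rw [bundleForm, DForm.d_add (smoothAt_patchedForm hβ hf p)
    ((smoothAt_pullback_proj_dTheta p).const_smul K), DForm.d_smul,
    DForm.d_pullback (smoothAt_dTheta _) (contMDiff_proj φ p), h, smul_zero, add_zero]

theorem pullback_fiberMap_d_patchedForm (hβ : ∀ x, β.SmoothAt x)
    (hf : f.IsSubordinate fun i => (Φ i).baseSet) (t : ℝ) :
    DForm.pullback I (fiberMap φ t) (patchedForm Φ f).d = β.d := by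
  funext x
  obtain ⟨h, hh, heq⟩ := exists_pullback_fiberMap_patchedForm hf t
  rw [← DForm.d_pullback (smoothAt_patchedForm hβ hf _) (contMDiff_fiberMap φ t x), heq,
    DForm.d_add (hβ x) (smoothAt_differential hh x), d_differential hh, add_zero]

theorem isExactSymplecticOnFibers_bundleForm (hβ : β.IsSmooth) (hdβ : β.d.IsNondegenerate)
    (hf : f.IsSubordinate fun i => (Φ i).baseSet) (K : ℝ) :
    IsExactSymplecticOnFibers φ (bundleForm Φ f K) := by
  intro t
  rw [d_bundleForm (DForm.isSmooth_iff.1 hβ) hf,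
    pullback_fiberMap_d_patchedForm (DForm.isSmooth_iff.1 hβ) hf]
  exact ⟨⟨β, hβ, rfl⟩, hdβ⟩

/-- `π^* dθ ∧ (dλ)ⁿ` vanishes nowhere for the patched form `λ`. -/
theorem wedge_dTheta_wedgePow_d_patchedForm_ne_zero [FiniteDimensional ℝ E] {n : ℕ}
    (hE : Module.finrank ℝ E = 2 * n) (hβ : ∀ x, β.SmoothAt x) (hdβ : β.d.IsNondegenerate)
    (hf : f.IsSubordinate fun i => (Φ i).baseSet) (p : MappingTorus φ) :
    wedge (DForm.pullback (I.prod 𝓘(ℝ, ℝ)) (proj φ) dTheta p).toAlternatingMap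
      (wedgePow ((patchedForm Φ f).d p).toAlternatingMap n) ≠ 0 := by
  obtain ⟨⟨x, t⟩, rfl⟩ := mk_surjective φ p
  have h1 := congrFun (pullback_fiberMap_d_patchedForm (φ := φ) hβ hf t) x
  have h2 := congrFun (pullback_fiberMap_pullback_proj (φ := φ) t dTheta) x
  -- A is the tangent map of the fibre inclusion, on whose image π^*dθ vanishes and dλ is dβ; the
  -- transverse vector is the velocity of s ↦ [x, s], where π^*dθ equals 2π.
  let A : E →L[ℝ] E × ℝ := mfderiv I (I.prod 𝓘(ℝ, ℝ)) (fiberMap φ t) x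
  have hvec : ∀ u w : E, (fun i => A (![u, w] i)) = ![A u, A w] := by
    intro u w
    funext i
    fin_cases i <;> rfl
  have hline : ContMDiff 𝓘(ℝ, ℝ) (I.prod 𝓘(ℝ, ℝ)) ∞ (fun s : ℝ => mk φ (x, s)) :=
    (contMDiff_mk φ).comp (contMDiff_const.prodMk contMDiff_id)
  refine wedge_wedgePow_ne_zero (V := E × ℝ) (W := E) A.toLinearMap hE ?_ ?_
    (v₀ := mfderiv 𝓘(ℝ, ℝ) (I.prod 𝓘(ℝ, ℝ)) (fun s : ℝ => mk φ (x, s)) t (1 : ℝ)) ?_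
  · intro u hu
    refine hdβ x u fun w => ?_
    refine Eq.trans ?_ (hu w)
    rw [← h1]
    exact congrArg ((patchedForm Φ f).d (mk φ (x, t))) (hvec u w)
  · intro u
    refine Eq.trans ?_ (DFunLike.congr_fun h2 (fun _ => u))
    exact congrArg (DForm.pullback (I.prod 𝓘(ℝ, ℝ)) (proj φ) dTheta (mk φ (x, t)))
      (const_fin_one_eq (A u)).symm
  · have h3 := DForm.pullback_comp_apply (I := 𝓘(ℝ, ℝ)) dTheta (x := t)
      ((contMDiff_proj φ).mdifferentiable (by simp) (mk φ (x, t)))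
      (hline.mdifferentiable (by simp) t)
    have h4 : proj φ ∘ (fun s : ℝ => mk φ (x, s)) = turn := rfl
    rw [h4] at h3
    have h5 : DForm.pullback 𝓘(ℝ, ℝ) turn dTheta t (fun _ => (1 : ℝ)) = 2 * Real.pi := by
      refine Eq.trans ?_ (dTheta_mfderiv_turn t)
      exact congrArg (dTheta (turn t)) (const_fin_one_eq (mfderiv 𝓘(ℝ, ℝ) (𝓡 1) turn t (1 : ℝ)))
    rw [h3] at h5
    have h6 : (2 * Real.pi : ℝ) ≠ 0 := by positivity
    rw [← h5] at h6
    intro h0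
    refine h6 (Eq.trans ?_ h0)
    exact congrArg (DForm.pullback (I.prod 𝓘(ℝ, ℝ)) (proj φ) dTheta (mk φ (x, t)))
      (const_fin_one_eq (mfderiv 𝓘(ℝ, ℝ) (I.prod 𝓘(ℝ, ℝ)) (fun s : ℝ => mk φ (x, s)) t (1 : ℝ)))

theorem exists_isContactForm_bundleForm [CompactSpace S] [FiniteDimensional ℝ E] {n : ℕ}
    (hE : Module.finrank ℝ E = 2 * n) (hβ : ∀ x, β.SmoothAt x) (hdβ : β.d.IsNondegenerate)
    (hf : f.IsSubordinate fun i => (Φ i).baseSet) :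
    ∃ K₀ : ℝ, 0 < K₀ ∧ ∀ K : ℝ, K₀ ≤ K → (bundleForm Φ f K).IsContactForm n := by
  have := compactSpace_mappingTorus φ
  obtain ⟨K₀, hK₀, h⟩ := exists_forall_wedge_wedgePow_ne_zero (smoothAt_patchedForm (φ := φ) hβ hf)
    smoothAt_pullback_proj_dTheta
    (wedge_dTheta_wedgePow_d_patchedForm_ne_zero hE hβ hdβ hf)
  refine ⟨K₀, hK₀, fun K hK => ⟨DForm.isSmooth_iff.2 (smoothAt_bundleForm hβ hf K), fun p => ?_⟩⟩
  rw [d_bundleForm hβ hf]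
  exact h K hK p

end PatchedForm

/-! ### Product structure near the boundary. -/

section BoundaryProduct

open MappingTorus

variable {E : Type*} [NormedAddCommGroup E] [NormedSpace ℝ E]
  {H : Type*} [TopologicalSpace H] {I : ModelWithCorners ℝ E H}
  {S : Type*} [TopologicalSpace S] [ChartedSpace H S]
  {β : DForm I S 1} {φ : S ≃ₘ⟮I, I⟯ S} {ι : Type*}
  {Φ : ι → ExactTrivialization β φ} {f : SmoothPartitionOfUnity ι (𝓡 1) Circle univ}

/-- Near t₀ only finitely many weights are nonzero, so finitely many neighbourhoods are intersected.
An index whose support misses `turn t₀` imposes no condition nearby. -/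
theorem eventually_trivialization_eq (hf : f.IsSubordinate fun i => (Φ i).baseSet) (t₀ : ℝ) :
    ∃ V ∈ 𝓝ˢ (I.boundary S), ∀ᶠ t in 𝓝 t₀, ∀ x ∈ V, ∀ i, f i (turn t) ≠ 0 →
      ((Φ i).toHomeo (fiberMap φ t x)).2 = x := by
  obtain ⟨s, hs⟩ := exists_finset_eventually_eq_sum f (turn t₀)
  have hone : ∀ i, ∃ V ∈ 𝓝ˢ (I.boundary S), ∀ᶠ t in 𝓝 t₀, ∀ x ∈ V, f i (turn t) ≠ 0 →
      ((Φ i).toHomeo (fiberMap φ t x)).2 = x := by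
    intro i
    by_cases ht : turn t₀ ∈ tsupport (f i)
    · obtain ⟨V, hV, h⟩ := (Φ i).eq_near_boundary t₀ (hf i ht)
      exact ⟨V, hV, h.mono fun t ht x hx _ => ht x hx⟩
    · refine ⟨univ, Filter.univ_mem, ?_⟩
      filter_upwards [contMDiff_turn.continuous.continuousAt.preimage_mem_nhds
        ((isClosed_tsupport _).isOpen_compl.mem_nhds ht)] with t ht x _ h0
      exact absurd (image_eq_zero_of_notMem_tsupport ht) h0
  choose V hV hVt using hone
  refine ⟨⋂ i ∈ s, V i, (Filter.biInter_finset_mem s).2 fun i _ => hV i, ?_⟩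
  filter_upwards [contMDiff_turn.continuous.continuousAt.eventually hs,
    (Filter.eventually_all_finset s).2 fun i _ => hVt i] with t ht hall x hx i hi
  exact hall i (ht i hi) x (mem_iInter₂.1 hx i (ht i hi)) hi

theorem fiberMap_eq_of_fixed {x : S} (hx : φ x = x) {s t : ℝ} (h : turn s = turn t) :
    fiberMap φ s x = fiberMap φ t x := by
  obtain ⟨m, rfl⟩ := turn_eq_turn.1 h
  have := fiberMap_add_int φ t m x
  rwa [zpow_apply_of_fixed φ hx] at this

/-- A neighbourhood of the boundary on which the monodromy and all trivializations that occur in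
the patched form are the identity. -/
theorem exists_nhds_boundary_eq_id (hφ : IsExactRelBoundary β φ)
    (hf : f.IsSubordinate fun i => (Φ i).baseSet) :
    ∃ V : Set S, IsOpen V ∧ I.boundary S ⊆ V ∧ (∀ x ∈ V, φ x = x) ∧
      ∀ t, ∀ x ∈ V, ∀ i, f i (turn t) ≠ 0 → ((Φ i).toHomeo (fiberMap φ t x)).2 = x := by
  obtain ⟨W, hW, hWt⟩ : ∃ W ∈ 𝓝ˢ (I.boundary S), ∀ t ∈ Icc (0 : ℝ) 1, ∀ x ∈ W, ∀ i,
      f i (turn t) ≠ 0 → ((Φ i).toHomeo (fiberMap φ t x)).2 = x := by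
    -- Compactness of one period turns the locally uniform neighbourhoods into a single one.
    refine isCompact_Icc.induction_on ⟨univ, Filter.univ_mem, fun t ht => ht.elim⟩ ?_ ?_ ?_
    · rintro T T' hT ⟨W, hW, h⟩
      exact ⟨W, hW, fun t ht => h t (hT ht)⟩
    · rintro T T' ⟨W, hW, h⟩ ⟨W', hW', h'⟩
      refine ⟨W ∩ W', Filter.inter_mem hW hW', ?_⟩
      rintro t (ht | ht) x hx
      · exact h t ht x hx.1
      · exact h' t ht x hx.2
    · intro t _
      obtain ⟨W, hW, h⟩ := eventually_trivialization_eq hf t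
      exact ⟨_, mem_nhdsWithin_of_mem_nhds h, W, hW, fun s hs => hs⟩
  refine ⟨interior (W ∩ {x | φ x = x}), isOpen_interior,
    subset_interior_iff_mem_nhdsSet.2 (Filter.inter_mem hW hφ.2),
    fun x hx => (interior_subset hx).2, fun t x hx i hi => ?_⟩
  obtain ⟨hxW, hxφ⟩ := interior_subset hx
  -- For fixed points of φ the class [x, t] depends on t only modulo 1, so one period suffices.
  have hfl : turn t = turn (Int.fract t) :=
    turn_eq_turn.2 ⟨⌊t⌋, (Int.fract_add_floor t).symm⟩
  rw [fiberMap_eq_of_fixed hxφ hfl]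
  rw [hfl] at hi
  exact hWt _ ⟨Int.fract_nonneg t, (Int.fract_lt_one t).le⟩ x hxW i hi

/-- All representatives of [x, t] are (φᵏ x, t + k), so for a fixed point the S-coordinate is well
defined; it provides the inverse of the product chart. -/
theorem lift_fst_of_fixed {x : S} (hx : φ x = x) (t : ℝ) : (lift φ (mk φ (x, t))).1 = x := by
  obtain ⟨k, hk⟩ := (mk_eq_iff φ).1 (mk_lift φ (mk φ (x, t))).symm
  rw [← hk]
  exact zpow_apply_of_fixed φ hx k

section ProductChart

variable {V : Set S}

theorem ne_turn_angleLift_add_half (z : Circle) : z ≠ turn (angleLift 0 z + 1 / 2) := by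
  intro h
  rw [← turn_angleLift 0 z] at h
  obtain ⟨m, hm⟩ := turn_eq_turn.1 h
  rw [turn_angleLift] at hm
  have h2 : (-1 : ℝ) = ((2 * m : ℤ) : ℝ) := by push_cast; linarith
  have h3 : (-1 : ℤ) = 2 * m := by exact_mod_cast h2
  omega

/-- `angleLift 0` jumps at -1, but over fixed points the branch is irrelevant. Near q it may be
replaced by the branch centred at the angle of q. -/
theorem contMDiffAt_productChart (hV : IsOpen V) (hVφ : ∀ x ∈ V, φ x = x)
    {q : S × Circle} (hq : q.1 ∈ V) :
    ContMDiffAt (I.prod (𝓡 1)) (I.prod 𝓘(ℝ, ℝ)) ∞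
      (fun q : S × Circle => fiberMap φ (angleLift 0 q.2) q.1) q := by
  have h1 : ContMDiffAt (I.prod (𝓡 1)) (I.prod 𝓘(ℝ, ℝ)) ∞
      (fun r : S × Circle => fiberMap φ (angleLift (angleLift 0 q.2) r.2) r.1) q :=
    (contMDiff_mk φ).contMDiffAt.comp q (contMDiffAt_fst.prodMk
      ((contMDiffAt_angleLift (ne_turn_angleLift_add_half q.2)).comp q contMDiffAt_snd))
  refine h1.congr_of_eventuallyEq ?_
  filter_upwards [continuous_fst.continuousAt.preimage_mem_nhds (hV.mem_nhds hq)] with r hr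
  exact fiberMap_eq_of_fixed (hVφ _ hr) (by rw [turn_angleLift, turn_angleLift])

variable [IsManifold I ∞ S]

theorem contMDiffAt_productChart_symm (hV : IsOpen V) (hVφ : ∀ x ∈ V, φ x = x)
    {p : MappingTorus φ} (hp : p ∈ mk φ '' (V ×ˢ univ)) :
    ContMDiffAt (I.prod 𝓘(ℝ, ℝ)) (I.prod (𝓡 1)) ∞
      (fun p : MappingTorus φ => ((lift φ p).1, proj φ p)) p := by
  obtain ⟨⟨x, t⟩, ⟨hx, -⟩, rfl⟩ := hp
  refine contMDiffAt_of_comp_mk φ ?_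
  have h1 : ContMDiffAt (I.prod 𝓘(ℝ, ℝ)) (I.prod (𝓡 1)) ∞
      (fun q : S × ℝ => (q.1, turn q.2)) (x, t) :=
    contMDiffAt_fst.prodMk (contMDiff_turn.contMDiffAt.comp (x, t) contMDiffAt_snd)
  refine h1.congr_of_eventuallyEq ?_
  filter_upwards [continuous_fst.continuousAt.preimage_mem_nhds (hV.mem_nhds hx)] with r hr
  exact Prod.ext (lift_fst_of_fixed (hVφ _ hr) r.2) rfl

/-- The embedding `(x, exp(2πit)) ↦ [x, t]` of `V × S¹`, for an open set `V` of fixed points. -/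
def productChart (hV : IsOpen V) (hVφ : ∀ x ∈ V, φ x = x) :
    OpenPartialHomeomorph (S × Circle) (MappingTorus φ) where
  toFun q := fiberMap φ (angleLift 0 q.2) q.1
  invFun p := ((lift φ p).1, proj φ p)
  source := V ×ˢ univ
  target := mk φ '' (V ×ˢ univ)
  map_source' q hq := ⟨(q.1, angleLift 0 q.2), ⟨hq.1, mem_univ _⟩, rfl⟩
  map_target' p hp := by
    obtain ⟨⟨x, t⟩, ⟨hx, -⟩, rfl⟩ := hp
    refine ⟨?_, mem_univ _⟩
    rw [lift_fst_of_fixed (hVφ x hx)]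
    exact hx
  left_inv' q hq := Prod.ext (lift_fst_of_fixed (hVφ _ hq.1) _) (turn_angleLift 0 q.2)
  right_inv' p hp := by
    obtain ⟨⟨x, t⟩, ⟨hx, -⟩, rfl⟩ := hp
    rw [lift_fst_of_fixed (hVφ x hx)]
    exact fiberMap_eq_of_fixed (hVφ x hx) (turn_angleLift 0 _)
  open_source := hV.prod isOpen_univ
  open_target := isOpenMap_mk φ _ (hV.prod isOpen_univ)
  continuousOn_toFun _ hq :=
    (contMDiffAt_productChart hV hVφ hq.1).continuousAt.continuousWithinAt
  continuousOn_invFun _ hp :=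
    (contMDiffAt_productChart_symm hV hVφ hp).continuousAt.continuousWithinAt

end ProductChart

theorem isProductNearBoundary_bundleForm [IsManifold I ∞ S] (hφ : IsExactRelBoundary β φ)
    (hf : f.IsSubordinate fun i => (Φ i).baseSet) (K : ℝ) :
    IsProductNearBoundary β φ K (bundleForm Φ f K) := by
  obtain ⟨V, hV, hbV, hVφ, hVt⟩ := exists_nhds_boundary_eq_id hφ hf
  refine ⟨V, productChart hV hVφ, hV, hbV, rfl, ?_, ?_, ?_, ?_, ?_⟩
  · intro p hp
    obtain ⟨x, hx, t, rfl⟩ := exists_boundary_lift φ hp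
    exact ⟨(x, t), ⟨hbV hx, mem_univ _⟩, rfl⟩
  · exact fun q hq => (contMDiffAt_productChart hV hVφ hq.1).contMDiffWithinAt
  · exact fun p hp => (contMDiffAt_productChart_symm hV hVφ hp).contMDiffWithinAt
  · exact fun x hx t => fiberMap_eq_of_fixed (hVφ x hx) (turn_angleLift 0 _)
  · rintro ⟨x, z⟩ ⟨hx, -⟩
    replace hx : x ∈ V := hx
    set Ψ : S × Circle → MappingTorus φ := ⇑(productChart hV hVφ)
    have hΨs : MDifferentiableAt (I.prod (𝓡 1)) (I.prod 𝓘(ℝ, ℝ)) Ψ (x, z) :=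
      (contMDiffAt_productChart hV hVφ hx).mdifferentiableAt (by simp)
    have hπΨ : proj φ ∘ Ψ = Prod.snd := funext fun q => turn_angleLift 0 q.2
    have hprojz : proj φ (Ψ (x, z)) = z := congrFun hπΨ (x, z)
    have hθ : DForm.pullback (I.prod (𝓡 1)) Ψ
        (DForm.pullback (I.prod 𝓘(ℝ, ℝ)) (proj φ) dTheta) (x, z) =
          DForm.pullback (I.prod (𝓡 1)) Prod.snd dTheta (x, z) := by
      rw [← DForm.pullback_comp_apply dTheta ((contMDiff_proj φ).mdifferentiable (by simp) _) hΨs,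
        hπΨ]
    have hterm : ∀ i, DForm.pullback (I.prod (𝓡 1)) Ψ (patchTerm Φ f i) (x, z) =
        f i z • DForm.pullback (I.prod (𝓡 1)) Prod.fst β (x, z) := by
      intro i
      have h1 : DForm.pullback (I.prod (𝓡 1)) Ψ (patchTerm Φ f i) (x, z) =
          f i (proj φ (Ψ (x, z))) • DForm.pullback (I.prod (𝓡 1)) Ψ
            (DForm.pullback (I.prod 𝓘(ℝ, ℝ)) (Φ i).toHomeo
              (DForm.pullback ((𝓡 1).prod I) (Prod.snd : Circle × S → S) β)) (x, z) := rfl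
      rw [h1, hprojz]
      by_cases h0 : f i z = 0
      · rw [h0, zero_smul, zero_smul]
      · congr 1
        have hd : MDifferentiableAt (I.prod 𝓘(ℝ, ℝ)) ((𝓡 1).prod I) (Φ i).toHomeo (Ψ (x, z)) :=
          ((Φ i).contMDiffAt (by rw [hprojz]; exact mem_baseSet_of_ne_zero hf h0)).mdifferentiableAt
            (by simp)
        rw [← DForm.pullback_comp_apply _ hd hΨs,
          ← DForm.pullback_comp_apply _ mdifferentiableAt_snd (hd.comp _ hΨs)]
        -- Pullback involves derivatives, so the maps must agree near (x, z). They do on the open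
        -- set where the point lies in V and fᵢ is nonzero.
        refine DForm.pullback_congr_apply β ?_
        have hopen : IsOpen {w | f i w ≠ 0} := isOpen_ne_fun (f i).contMDiff.continuous continuous_const
        filter_upwards [(hV.prod hopen).mem_nhds ⟨hx, h0⟩] with q hq
        refine hVt (angleLift 0 q.2) q.1 hq.1 i ?_
        rw [turn_angleLift]
        exact hq.2
    obtain ⟨s, hs⟩ := exists_finset_eventually_eq_sum f z
    have hs := hs.self_of_nhds
    have hpatch : DForm.pullback (I.prod (𝓡 1)) Ψ (patchedForm Φ f) (x, z) =
        DForm.pullback (I.prod (𝓡 1)) Prod.fst β (x, z) := by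
      have h1 : patchedForm Φ f (Ψ (x, z)) = ∑ i ∈ s, patchTerm Φ f i (Ψ (x, z)) :=
        patchedForm_eq_sum (by rw [hprojz]; exact hs)
      have h2 : DForm.pullback (I.prod (𝓡 1)) Ψ (patchedForm Φ f) (x, z) =
          ∑ i ∈ s, DForm.pullback (I.prod (𝓡 1)) Ψ (patchTerm Φ f i) (x, z) := by
        ext v
        rw [DForm.pullback, h1]
        simp [DForm.pullback, ContinuousAlternatingMap.sum_apply]
      rw [h2, Finset.sum_congr rfl fun i _ => hterm i, ← Finset.sum_smul, sum_eq_one hs, one_smul]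
    rw [← hpatch, ← hθ]
    rfl

end BoundaryProduct

end ContactTorus

end

/-! ### The theorem. -/

open ContactTorus in
theorem mainTheorem4 {n : ℕ} [NeZero n]
    {S : Type*} [TopologicalSpace S] [T2Space S] [CompactSpace S]
    [ChartedSpace (EuclideanHalfSpace (2 * n)) S] [IsManifold (𝓡∂ (2 * n)) ∞ S]
    (β : DForm (𝓡∂ (2 * n)) S 1) (hβ : β.IsSmooth) (hdβ : β.d.IsNondegenerate)
    (hconvex : HasConvexBoundary β)
    (φ : S ≃ₘ⟮𝓡∂ (2 * n), 𝓡∂ (2 * n)⟯ S) (hφ : IsExactRelBoundary β φ) :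
    (∃ (Φ : Fin 2 → ExactTrivialization β φ)
      (f : SmoothPartitionOfUnity (Fin 2) (𝓡 1) Circle univ),
      f.IsSubordinate fun i => (Φ i).baseSet) ∧
    ∀ {ι : Type*} (Φ : ι → ExactTrivialization β φ)
      (f : SmoothPartitionOfUnity ι (𝓡 1) Circle univ),
      f.IsSubordinate (fun i => (Φ i).baseSet) →
      ∃ K₀ : ℝ, 0 < K₀ ∧ ∀ K : ℝ, K₀ ≤ K →
        (bundleForm Φ f K).IsContactForm n ∧
        IsExactSymplecticOnFibers φ (bundleForm Φ f K) ∧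
        IsProductNearBoundary β φ K (bundleForm Φ f K) := by
  refine ⟨exists_trivializations hφ, fun Φ f hf => ?_⟩
  obtain ⟨K₀, hK₀, h⟩ := exists_isContactForm_bundleForm (Φ := Φ) (f := f) (n := n)
    finrank_euclideanSpace_fin (DForm.isSmooth_iff.1 hβ) hdβ hf
  exact ⟨K₀, hK₀, fun K hK => ⟨h K hK, isExactSymplecticOnFibers_bundleForm hβ hdβ hf K,
    isProductNearBoundary_bundleForm hφ hf K⟩⟩
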